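/- A (rational) mould over $\mathbb{Q}$ is a family $A=(A_r)_{r\ge 0}$ with $A_r\in\mathbb{Q}(u_1,\dots,u_r)$; write $A(w_1,\dots,w_r)=A_r(w_1,\dots,w_r)$. Let $\mathrm{ARI}$ be the space of moulds with $A(\varnothing)=0$. For $1\le r$ and a factorization $(u_1,\dots,u_r)=abc$ with $a=(u_1,\dots,u_k)$, $b=(u_{k+1},\dots,u_\ell)$, $c=(u_{\ell+1},\dots,u_r)$, put $a\lceil c=(u_1,\dots,u_k,\,u_{k+1}+\cdots+u_{\ell+1},\,u_{\ell+2},\dots,u_r)$ if $c\ne\varnothing$ and $a\rceil c=(u_1,\dots,u_{k-1},\,u_k+\cdots+u_\ell,\,u_{\ell+1},\dots,u_r)$ if $a\neq\varnothing$. Define $$(\mathrm{arit}(B)\cdot A)(u_1,\dots,u_r)=\sum_{0\le k<\ell<r}A(a\lceil c)B(b)-\sum_{1\le k<\ell\le r}A(a\rceil c)B(b),$$ $$\mathrm{mu}(A,B)(u_1,\dots,u_r)=\sum_{i=0}^rA(u_1,\dots,u_i)B(u_{i+1},\dots,u_r),\qquad \mathrm{lu}(A,B)=\mathrm{mu}(A,B)-\mathrm{mu}(B,A),$$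 $$\mathrm{ari}(A,B)=\mathrm{arit}(B)\cdot A-\mathrm{arit}(A)\cdot B+\mathrm{lu}(A,B).$$ A mould $A$ is alternal if for all $r>1$ and $1\le s<r$ one has $\sum_\sigma A(u_{\sigma^{-1}(1)},\dots,u_{\sigma^{-1}(r)})=0$, where $\sigma$ runs over the permutations of $\{1,\dots,r\}$ with $\sigma(1)<\cdots<\sigma(s)$ and $\sigma(s+1)<\cdots<\sigma(r)$. Let $\mathrm{swap}(A)(v_1,\dots,v_r)=A(v_r,v_{r-1}-v_r,\dots,v_1-v_2)$; $A$ is bialternal if $A$ and $\mathrm{swap}(A)$ are both alternal. Let $\mathrm{ARI}_{\underline{al}/\underline{al}}$ be the set of bialternal moulds in $\mathrm{ARI}$ whose depth-$1$ part $A_1(u_1)$ is an even function, and let $\mathrm{ARI}^{\mathrm{sing}}$ be the set of moulds $A\in\mathrm{ARI}$ such that $u_1\cdots u_r(u_1+\cdots+u_r)A_r(u_1,\dots,u_r)$ is a polynomial for every $r\ge1$. **Theorem.** $\mathrm{ARI}^{\mathrm{sing}}_{\underline{al}/\underline{al}}=\mathrm{ARI}_{\underline{al}/\underline{al}}\cap\mathrm{ARI}^{\mathrm{sing}}$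 is closed under the ari-bracket, and it is a Lie algebra over $\mathbb{Q}$ under this bracket. -/

import Mathlib

/-- The field `ℚ(u₁, …, u_r)` of rational functions in `r` commuting variables. -/
abbrev RatFun (r : ℕ) : Type := FractionRing (MvPolynomial (Fin r) ℚ)

/-- The value of a rational function `f ∈ ℚ(u₁, …, u_r)` at `x = (x₁, …, x_r)` with entries in a
field `K` of characteristic zero, computed from the reduced fraction of `f`. In this development
it is only used at tuples `x` that are linearly independent linear forms in variables
`u₁, …, u_n` (with `K = ℚ(u₁, …, u_n)`), at which no denominator vanishes, so there it is the usual
substitution of variables. -/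
noncomputable def RatFun.eval {r : ℕ} {K : Type*} [Field K] [Algebra ℚ K]
    (f : RatFun r) (x : Fin r → K) : K :=
  MvPolynomial.aeval x (IsFractionRing.num (MvPolynomial (Fin r) ℚ) f) /
    MvPolynomial.aeval x (IsFractionRing.den (MvPolynomial (Fin r) ℚ) f : MvPolynomial (Fin r) ℚ)

/-- The value does not depend on the fraction `p / q` that represents the rational function, as
long as `q` does not vanish at `x`. -/
theorem RatFun.eval_div {r : ℕ} {K : Type*} [Field K] [Algebra ℚ K]
    (p q : MvPolynomial (Fin r) ℚ) (x : Fin r → K) (hq : MvPolynomial.aeval x q ≠ 0) :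
    RatFun.eval (algebraMap (MvPolynomial (Fin r) ℚ) (RatFun r) p /
      algebraMap (MvPolynomial (Fin r) ℚ) (RatFun r) q) x =
      MvPolynomial.aeval x p / MvPolynomial.aeval x q := by
  set f : RatFun r := algebraMap (MvPolynomial (Fin r) ℚ) (RatFun r) p /
    algebraMap (MvPolynomial (Fin r) ℚ) (RatFun r) q with hf
  set n := IsFractionRing.num (MvPolynomial (Fin r) ℚ) f with hn
  set d := (IsFractionRing.den (MvPolynomial (Fin r) ℚ) f : MvPolynomial (Fin r) ℚ) with hd
  have inj := IsFractionRing.injective (MvPolynomial (Fin r) ℚ) (RatFun r)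
  have hd0 : d ≠ 0 := nonZeroDivisors.ne_zero (IsFractionRing.den _ f).2
  have hq0 : q ≠ 0 := by
    rintro rfl
    simp at hq
  have key : n * q = p * d := by
    apply inj
    have h := IsFractionRing.mk'_num_den' (MvPolynomial (Fin r) ℚ) f
    rw [← hn, ← hd, hf, div_eq_div_iff
      ((map_ne_zero_iff _ inj).2 hd0) ((map_ne_zero_iff _ inj).2 hq0)] at h
    simpa only [map_mul] using h
  have hrel : IsRelPrime n d := IsFractionRing.num_den_reduced _ f
  have hdvd : d ∣ q := hrel.symm.dvd_of_dvd_mul_left ⟨p, by rw [key, mul_comm]⟩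
  have hdx : MvPolynomial.aeval x d ≠ 0 := by
    obtain ⟨c, hc⟩ := hdvd
    intro h0
    apply hq
    rw [hc, map_mul, h0, zero_mul]
  change MvPolynomial.aeval x n / MvPolynomial.aeval x d = _
  rw [div_eq_div_iff hdx hq, ← map_mul, ← map_mul, key]

/-- Rational-function valued moulds over `ℚ`: families `(A_r)_{r ≥ 0}` with
`A_r ∈ ℚ(u₁, …, u_r)`. The same type serves for moulds in the variables `v_i`. -/
abbrev Mould : Type := (r : ℕ) → RatFun r

namespace Mould

/-- `A(w₁, …, w_r) = A_r(w₁, …, w_r)` for a word `w = (w₁, …, w_r)` in a field. -/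
noncomputable def evalWord {K : Type*} [Field K] [Algebra ℚ K] (A : Mould) (w : List K) : K :=
  RatFun.eval (A w.length) w.get

/-- The variable `u_{i+1}` of `ℚ(u₁, …, u_r)`. -/
noncomputable def var {r : ℕ} (i : Fin r) : RatFun r :=
  algebraMap (MvPolynomial (Fin r) ℚ) (RatFun r) (MvPolynomial.X i)

/-- The word `(u₁, …, u_r)`. -/
noncomputable def vars (r : ℕ) : List (RatFun r) := List.ofFn var

/-- The word `a⌈c` with respect to a decomposition `w = abc`: the sum of the letters of `b` is
added to the first letter of `c` (only used for `c ≠ ∅`). -/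
def flexR {K : Type*} [Field K] (a b : List K) : List K → List K
  | [] => a
  | x :: c => a ++ (b.sum + x) :: c

/-- The word `a⌉c` with respect to a decomposition `w = abc`: the sum of the letters of `b` is
added to the last letter of `a` (only used for `a ≠ ∅`). -/
def flexL {K : Type*} [Field K] (a b c : List K) : List K :=
  a.dropLast ++ (a.getLastD 0 + b.sum) :: c

/-- `(arit(B)·A)(u₁, …, u_r) = ∑_{0 ≤ k < l < r} A(a⌈c) B(b) - ∑_{1 ≤ k < l ≤ r} A(a⌉c) B(b)`, where
`a = (u₁, …, u_k)`, `b = (u_{k+1}, …, u_l)`, `c = (u_{l+1}, …, u_r)`. -/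
noncomputable def arit (B A : Mould) : Mould := fun r =>
  (∑ k ∈ Finset.range r, ∑ l ∈ Finset.Ioo k r,
      A.evalWord (flexR ((vars r).take k) (((vars r).take l).drop k) ((vars r).drop l)) *
        B.evalWord (((vars r).take l).drop k)) -
    ∑ k ∈ Finset.Icc 1 r, ∑ l ∈ Finset.Ioc k r,
      A.evalWord (flexL ((vars r).take k) (((vars r).take l).drop k) ((vars r).drop l)) *
        B.evalWord (((vars r).take l).drop k)

/-- `mu(A, B)(u₁, …, u_r) = ∑_{i=0}^{r} A(u₁, …, u_i) B(u_{i+1}, …, u_r)`. -/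
noncomputable def mu (A B : Mould) : Mould := fun r =>
  ∑ i ∈ Finset.range (r + 1), A.evalWord ((vars r).take i) * B.evalWord ((vars r).drop i)

/-- `lu(A, B) = mu(A, B) - mu(B, A)`. -/
noncomputable def lu (A B : Mould) : Mould := mu A B - mu B A

/-- The ari-bracket `ari(A, B) = arit(B)·A - arit(A)·B + lu(A, B)`. -/
noncomputable def ari (A B : Mould) : Mould := arit B A - arit A B + lu A B

/-- `swap(A)(v₁, …, v_r) = A(v_r, v_{r-1} - v_r, …, v₁ - v₂)`. -/
noncomputable def swap (A : Mould) : Mould := fun r =>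
  RatFun.eval (A r) fun i =>
    if h : i.val = 0 then var i.rev else var i.rev - var (⟨r - i.val, by omega⟩ : Fin r)

/-- `A` is alternal: for all `r > 1` and `1 ≤ s < r`, the sum of
`A(u_{σ⁻¹(1)}, …, u_{σ⁻¹(r)})` over the permutations `σ` of `{1, …, r}` with
`σ(1) < ⋯ < σ(s)` and `σ(s+1) < ⋯ < σ(r)` vanishes. -/
def IsAlternal (A : Mould) : Prop :=
  ∀ r s : ℕ, 1 ≤ s → s < r →
    ∑ σ : Equiv.Perm (Fin r) with
        (∀ i j : Fin r, i < j → j.val < s → σ i < σ j) ∧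
        (∀ i j : Fin r, i < j → s ≤ i.val → σ i < σ j),
      RatFun.eval (A r) (fun i => var (σ.symm i)) = 0

/-- The underlying space of `ARI`: moulds with `A(∅) = 0`. -/
def ARI : Set Mould := {A | A 0 = 0}

/-- Moulds in `ARI` that are bialternal (`A` and `swap(A)` are alternal) and whose depth 1 part is
an even function. -/
def ARIalal : Set Mould :=
  {A | A ∈ ARI ∧ A.IsAlternal ∧ (swap A).IsAlternal ∧
    RatFun.eval (A 1) (fun i => -var i) = A 1}

/-- `Δ_r(u₁, …, u_r) = u₁ ⋯ u_r (u₁ + ⋯ + u_r)`. -/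
noncomputable def Δ (r : ℕ) : RatFun r := (∏ i, var i) * ∑ i, var i

/-- Moulds in `ARI` such that `Δ_r A_r` is a polynomial for each `r ≥ 1`. -/
def ARIsing : Set Mould :=
  {A | A ∈ ARI ∧ ∀ r : ℕ, 1 ≤ r → ∃ p : MvPolynomial (Fin r) ℚ,
    Δ r * A r = algebraMap (MvPolynomial (Fin r) ℚ) (RatFun r) p}

end Mould

/-! ### Sums over the factorizations and the shuffles of words -/

/-! A mould is regarded as a function on words of linearly independent linear forms, extended by
zero to all other words (`fn`). Such forms are algebraically independent, so evaluation at them is a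
homomorphism of fields (`RatFun.evalHom`), and genericity survives permutations, subwords, the
contractions a⌈c and a⌉c, and partial sums. The claims thus become identities between functions on
lists, written with the recursive sums `spl`, `splL` and `sh`.

Alternality of the bracket rests on `IsAlt.ins`. In a shuffle of x and y, alternality of the
inserted function forces the removed factor to come from one word only. If the absorbing letter
belongs to the same word, what remains is a vanishing shuffle sum of A. If it belongs to the other
word, the term is the same whether the factor stood to the left or to the right of the letter, and
cancels in the difference that defines arit. The lu part is classical (`IsAlt.lu`).

For the swap, a word is written as the differences of a sequence of points; a contraction then
deletes points. If B is invariant under cyclic rotation of its points (push-invariance), the removed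
factor can always be based at a retained point, and the swapped bracket is again insertions plus a
lu bracket (`aritF_dif`), so `IsAlt.ins` applies once more. Push-invariance follows from
bialternality: the two reversal rules give rotation up to negating the arguments, and evenness in
depth 1 propagates to every depth (`IsAlt.map_neg`).

For the poles, multiply by Δ and expand in partial fractions. Poles occur along Σb for a removed
factor b and along Σf for a contracted factor f. At Σb = 0 the words a⌈c and a⌉c both reduce to ac,
the boundary cases being supplied by lu. At Σf = 0 the two numerators agree by push-invariance.
Hence every term is a polynomial (`mul_ariF_mem`).

For the Jacobi identity, arit(B) is a coderivation `der (flank B)`. The commutator of two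
coderivations is a coderivation, and the one obtained here belongs to the ari-bracket
(`der_flank_sub`); together with the Leibniz rule for mu the identity becomes formal. -/

namespace WordSum

section Basic

variable {V K M : Type*} [AddCommMonoid K] [AddCommMonoid M]

/-- The sum of `F a b` over all factorizations `w = ab`. -/
def spl (F : List V → List V → K) : List V → K
  | [] => F [] []
  | z :: w => F [] (z :: w) + spl (fun a b => F (z :: a) b) w

/-- The sum of `F a z c` over all factorizations `w = azc` with `z` a letter. -/
def splL (F : List V → V → List V → K) : List V → K
  | [] => 0
  | z :: w => F [] z w + splL (fun a y c => F (z :: a) y c) w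

/-- The sum of `F w` over all shuffles `w` of `x` and `y`. -/
def sh (F : List V → K) : List V → List V → K
  | [], y => F y
  | a :: x, [] => F (a :: x)
  | a :: x, b :: y => sh (fun w => F (a :: w)) x (b :: y) + sh (fun w => F (b :: w)) (a :: x) y
termination_by x y => x.length + y.length

@[simp] theorem spl_nil (F : List V → List V → K) : spl F [] = F [] [] := rfl

theorem spl_cons (F : List V → List V → K) (z : V) (w : List V) :
    spl F (z :: w) = F [] (z :: w) + spl (fun a b => F (z :: a) b) w := rfl

@[simp] theorem splL_nil (F : List V → V → List V → K) : splL F [] = 0 := rfl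

theorem splL_cons (F : List V → V → List V → K) (z : V) (w : List V) :
    splL F (z :: w) = F [] z w + splL (fun a y c => F (z :: a) y c) w := rfl

@[simp] theorem sh_nil_left (F : List V → K) (y : List V) : sh F [] y = F y := by rw [sh]

@[simp] theorem sh_nil_right (F : List V → K) (x : List V) : sh F x [] = F x := by
  cases x <;> rw [sh]

theorem sh_cons_cons (F : List V → K) (a b : V) (x y : List V) :
    sh F (a :: x) (b :: y) =
      sh (fun w => F (a :: w)) x (b :: y) + sh (fun w => F (b :: w)) (a :: x) y := by
  rw [sh]

/-- Induction along the recursion of `sh`. -/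
theorem sh_induction {P : List V → List V → Prop} (h1 : ∀ y, P [] y) (h2 : ∀ x, P x [])
    (h3 : ∀ a x b y, P x (b :: y) → P (a :: x) y → P (a :: x) (b :: y)) (x y : List V) :
    P x y := by
  induction x generalizing y with
  | nil => exact h1 y
  | cons a x ihx =>
    induction y with
    | nil => exact h2 _
    | cons b y ihy => exact h3 a x b y (ihx _) ihy

theorem spl_congr {F G : List V → List V → K} {w : List V}
    (h : ∀ a b, w = a ++ b → F a b = G a b) : spl F w = spl G w := by
  induction w generalizing F G with
  | nil => exact h _ _ rfl
  | cons z w ih =>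
    rw [spl_cons, spl_cons, h [] _ rfl, ih]
    rintro a b rfl
    exact h _ _ rfl

theorem splL_congr {F G : List V → V → List V → K} {w : List V}
    (h : ∀ a z c, w = a ++ z :: c → F a z c = G a z c) : splL F w = splL G w := by
  induction w generalizing F G with
  | nil => rfl
  | cons z w ih =>
    rw [splL_cons, splL_cons, h [] _ _ rfl, ih]
    rintro a y c rfl
    exact h _ _ _ rfl

theorem sh_congr {F G : List V → K} {x y : List V}
    (h : ∀ w, w.Perm (x ++ y) → F w = G w) : sh F x y = sh G x y := by
  induction x, y using sh_induction generalizing F G with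
  | h1 y => simpa using h y (by simp)
  | h2 x => simpa using h x (by simp)
  | h3 a x b y ih1 ih2 =>
    rw [sh_cons_cons, sh_cons_cons, ih1 (F := fun w => F (a :: w)) (G := fun w => G (a :: w)),
      ih2 (F := fun w => F (b :: w)) (G := fun w => G (b :: w))]
    · intro w hw
      refine h _ ((hw.cons b).trans ?_)
      exact List.perm_middle.symm
    · intro w hw
      exact h _ (hw.cons a)

theorem map_spl (Φ : K →+ M) (F : List V → List V → K) (w : List V) :
    Φ (spl F w) = spl (fun a b => Φ (F a b)) w := by
  induction w generalizing F with
  | nil => rfl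
  | cons z w ih => rw [spl_cons, spl_cons, map_add, ih]

theorem map_splL (Φ : K →+ M) (F : List V → V → List V → K) (w : List V) :
    Φ (splL F w) = splL (fun a z c => Φ (F a z c)) w := by
  induction w generalizing F with
  | nil => exact map_zero Φ
  | cons z w ih => rw [splL_cons, splL_cons, map_add, ih]

theorem map_sh (Φ : K →+ M) (F : List V → K) (x y : List V) :
    Φ (sh F x y) = sh (fun w => Φ (F w)) x y := by
  induction x, y using sh_induction generalizing F with
  | h1 y => simp
  | h2 x => simp
  | h3 a x b y ih1 ih2 => rw [sh_cons_cons, sh_cons_cons, map_add, ih1, ih2]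

theorem spl_add (F G : List V → List V → K) (w : List V) :
    spl (fun a b => F a b + G a b) w = spl F w + spl G w := by
  induction w generalizing F G with
  | nil => rfl
  | cons z w ih => simp only [spl_cons, ih]; abel

theorem splL_add (F G : List V → V → List V → K) (w : List V) :
    splL (fun a z c => F a z c + G a z c) w = splL F w + splL G w := by
  induction w generalizing F G with
  | nil => simp
  | cons z w ih => simp only [splL_cons, ih]; abel

theorem sh_add (F G : List V → K) (x y : List V) :
    sh (fun w => F w + G w) x y = sh F x y + sh G x y := by
  induction x, y using sh_induction generalizing F G with
  | h1 y => simp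
  | h2 x => simp
  | h3 a x b y ih1 ih2 => simp only [sh_cons_cons, ih1, ih2]; abel

@[simp] theorem spl_zero (w : List V) : spl (fun _ _ => (0 : K)) w = 0 := by
  induction w with
  | nil => rfl
  | cons z w ih => rw [spl_cons, ih, add_zero]

@[simp] theorem splL_zero (w : List V) : splL (fun _ _ _ => (0 : K)) w = 0 := by
  induction w with
  | nil => rfl
  | cons z w ih => rw [splL_cons, ih, add_zero]

@[simp] theorem sh_zero (x y : List V) : sh (fun _ => (0 : K)) x y = 0 := by
  induction x, y using sh_induction with
  | h1 y => simp
  | h2 x => simp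
  | h3 a x b y ih1 ih2 => rw [sh_cons_cons, ih1, ih2, add_zero]

/-- The sum over factorizations as an additive map. -/
def splHom (w : List V) : (List V → List V → K) →+ K where
  toFun F := spl F w
  map_zero' := spl_zero w
  map_add' F G := spl_add F G w

/-- The sum over shuffles as an additive map. -/
def shHom (x y : List V) : (List V → K) →+ K where
  toFun F := sh F x y
  map_zero' := sh_zero x y
  map_add' F G := sh_add F G x y

theorem spl_apply {ι : Type*} (F : List V → List V → ι → K) (w : List V) (i : ι) :
    spl F w i = spl (fun a b => F a b i) w :=
  map_spl (Pi.evalAddMonoidHom (fun _ : ι => K) i) F w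

/-- The inner sum is an additive map on a space of functions, so it commutes with the outer sum by
`map_spl`. -/
theorem spl_comm (F : List V → List V → List V → List V → K) (x y : List V) :
    spl (fun a b => spl (fun c d => F a b c d) y) x =
      spl (fun c d => spl (fun a b => F a b c d) x) y := by
  have h := map_spl (splHom (K := K) y) (fun a b c d => F a b c d) x
  refine h.symm.trans ?_
  change spl (fun c d => spl F x c d) y = _
  simp only [spl_apply]

theorem sh_spl_comm (F : List V → List V → List V → K) (x y w : List V) :
    sh (fun v => spl (fun a b => F a b v) w) x y = spl (fun a b => sh (F a b) x y) w := by
  have h := map_spl (shHom (K := K) x y) F w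
  refine Eq.trans ?_ h
  change _ = sh (fun v => spl F w v) x y
  simp only [spl_apply]

theorem sh_comm (F : List V → K) (x y : List V) : sh F x y = sh F y x := by
  induction x, y using sh_induction generalizing F with
  | h1 y => simp
  | h2 x => simp
  | h3 a x b y ih1 ih2 => rw [sh_cons_cons, sh_cons_cons, ih1, ih2, add_comm]

theorem spl_eq_nil_left (F : List V → List V → K) (w : List V) :
    spl F w = F [] w + splL (fun a z c => F (a ++ [z]) c) w := by
  induction w generalizing F with
  | nil => simp
  | cons z w ih => rw [spl_cons, splL_cons, ih]; rfl

theorem spl_eq_nil_right (F : List V → List V → K) (w : List V) :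
    spl F w = F w [] + splL (fun a z c => F a (z :: c)) w := by
  induction w generalizing F with
  | nil => simp
  | cons z w ih => rw [spl_cons, splL_cons, ih]; abel

theorem spl_append_singleton (F : List V → List V → K) (w : List V) (y : V) :
    spl F (w ++ [y]) = spl (fun a b => F a (b ++ [y])) w + F (w ++ [y]) [] := by
  induction w generalizing F with
  | nil => simp [spl_cons]
  | cons z w ih => simp only [List.cons_append, spl_cons, ih]; abel

theorem spl_assoc (F : List V → List V → List V → K) (w : List V) :
    spl (fun s c => spl (fun a b => F a b c) s) w =
      spl (fun a s => spl (fun b c => F a b c) s) w := by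
  induction w generalizing F with
  | nil => rfl
  | cons z w ih =>
    simp only [spl_cons, spl_nil, spl_add, ih, add_assoc]

theorem splL_spl (F : List V → List V → V → List V → K) (w : List V) :
    splL (fun s z c => spl (fun a b => F a b z c) s) w =
      spl (fun a t => splL (fun b z c => F a b z c) t) w := by
  induction w generalizing F with
  | nil => rfl
  | cons z w ih =>
    simp only [spl_cons, spl_nil, splL_cons, splL_add, ih, add_assoc]

theorem spl_append_cons (F : List V → List V → K) (a c : List V) (z : V) :
    spl F (a ++ z :: c) = spl (fun a₁ a₂ => F a₁ (a₂ ++ z :: c)) a +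
      spl (fun c₁ c₂ => F (a ++ z :: c₁) c₂) c := by
  induction a generalizing F with
  | nil => rfl
  | cons y a ih => simp only [List.cons_append, spl_cons, ih, add_assoc]

/-- A factor b followed by a letter z is the same as a nonempty factor f = bz; the hypothesis
discards the empty f. This and its mirror image let left and right insertions be compared on common
factors. -/
theorem spl_append_left (F : List V → List V → List V → K)
    (hF : ∀ a c, F a [] c = 0) (w : List V) :
    splL (fun s z c => spl (fun a b => F a (b ++ [z]) c) s) w =
      spl (fun a t => spl (fun f c => F a f c) t) w := by
  rw [splL_spl]
  congr 1
  funext a t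
  rw [spl_eq_nil_left, hF, zero_add]

theorem spl_append_right (F : List V → List V → List V → K)
    (hF : ∀ a c, F a [] c = 0) (w : List V) :
    splL (fun a z s => spl (fun b c => F a (z :: b) c) s) w =
      spl (fun a t => spl (fun f c => F a f c) t) w := by
  rw [spl_eq_nil_right]
  simp only [spl_nil, hF, spl_cons, zero_add]

/-- Deconcatenation is a morphism for the shuffle product. -/
theorem sh_spl (F : List V → List V → K) (x y : List V) :
    sh (spl F) x y = spl (fun x₁ x₂ => spl (fun y₁ y₂ =>
      sh (fun a => sh (fun b => F a b) x₂ y₂) x₁ y₁) y) x := by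
  induction x, y using sh_induction generalizing F with
  | h1 y => simp
  | h2 x => simp
  | h3 a x b y ih1 ih2 =>
    simp only [sh_cons_cons, spl_cons]
    rw [sh_add, sh_add, ih1, ih2]
    simp only [spl_cons, sh_nil_left, sh_nil_right, spl_add]
    abel

theorem sh_splL (F : List V → V → List V → K) (x y : List V) :
    sh (splL F) x y =
      splL (fun x₁ z x₂ => spl (fun y₁ y₂ =>
        sh (fun a => sh (fun c => F a z c) x₂ y₂) x₁ y₁) y) x +
      splL (fun y₁ z y₂ => spl (fun x₁ x₂ =>
        sh (fun a => sh (fun c => F a z c) x₂ y₂) x₁ y₁) x) y := by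
  induction x, y using sh_induction generalizing F with
  | h1 y => simp
  | h2 x => simp
  | h3 a x b y ih1 ih2 =>
    simp only [sh_cons_cons, splL_cons]
    rw [sh_add, sh_add, ih1, ih2]
    simp only [sh_cons_cons, spl_cons, splL_cons, sh_nil_left, sh_nil_right, spl_add, splL_add]
    abel

/-- The marked letter z cuts y into the letters shuffled before it and those shuffled after it. -/
theorem sh_append_cons (F : List V → K) (x₁ x₂ y : List V) (z : V) :
    sh F (x₁ ++ z :: x₂) y =
      spl (fun y₁ y₂ => sh (fun a => sh (fun c => F (a ++ z :: c)) x₂ y₂) x₁ y₁) y := by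
  induction x₁, y using sh_induction generalizing F with
  | h1 y =>
    induction y generalizing F with
    | nil => simp
    | cons b y ih =>
      simp only [List.nil_append] at ih ⊢
      rw [sh_cons_cons, ih, spl_cons]
      simp
  | h2 x => simp
  | h3 a x b y ih1 ih2 =>
    rw [List.cons_append, sh_cons_cons, ih1, ← List.cons_append, ih2]
    simp only [sh_cons_cons, spl_cons, sh_nil_right, spl_add, List.cons_append]
    abel

theorem sh_map {W : Type*} (g : V → W) (F : List W → K) (x y : List V) :
    sh F (x.map g) (y.map g) = sh (fun w => F (w.map g)) x y := by
  induction x, y using sh_induction generalizing F with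
  | h1 y => simp
  | h2 x => simp
  | h3 a x b y ih1 ih2 =>
    simp only [List.map_cons] at ih1 ih2 ⊢
    rw [sh_cons_cons, sh_cons_cons, ih1, ih2]
    rfl

theorem sh_append_singleton (F : List V → K) (x y : List V) (a b : V) :
    sh F (x ++ [a]) (y ++ [b]) =
      sh (fun w => F (w ++ [a])) x (y ++ [b]) + sh (fun w => F (w ++ [b])) (x ++ [a]) y := by
  induction x, y using sh_induction generalizing F with
  | h1 y =>
    induction y generalizing F with
    | nil => simp [sh_cons_cons, add_comm]
    | cons c y ih =>
      simp only [List.cons_append, List.nil_append, sh_cons_cons, sh_nil_left] at ih ⊢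
      rw [ih]; abel
  | h2 x =>
    induction x generalizing F with
    | nil => simp [sh_cons_cons, add_comm]
    | cons c y ih =>
      simp only [List.cons_append, List.nil_append, sh_cons_cons, sh_nil_right] at ih ⊢
      rw [ih]; abel
  | h3 c x d y ih1 ih2 =>
    simp only [List.cons_append] at ih1 ih2 ⊢
    simp only [sh_cons_cons, ih1, ih2, List.cons_append]
    abel

theorem sh_reverse (F : List V → K) (x y : List V) :
    sh F x.reverse y.reverse = sh (fun w => F w.reverse) x y := by
  induction x, y using sh_induction generalizing F with
  | h1 y => simp
  | h2 x => simp
  | h3 a x b y ih1 ih2 =>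
    simp only [List.reverse_cons] at ih1 ih2 ⊢
    rw [sh_append_singleton, sh_cons_cons, ih1, ih2]
    simp

theorem spl_eq_sum (F : List V → List V → K) (w : List V) :
    spl F w = ∑ i ∈ Finset.range (w.length + 1), F (w.take i) (w.drop i) := by
  induction w generalizing F with
  | nil => simp
  | cons z w ih => rw [spl_cons, ih, List.length_cons, Finset.sum_range_succ' _ (w.length + 1)]; simp [add_comm]

end Basic

end WordSum

/-! ### Alternal functions on words and insertion operators -/

namespace WordSum

section Alternal

variable {V K : Type*} [CommRing K]

theorem spl_mul_right (F : List V → List V → K) (k : K) (w : List V) :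
    spl (fun a b => F a b * k) w = spl F w * k :=
  (map_spl (AddMonoidHom.mulRight k) F w).symm

theorem spl_mul_left (F : List V → List V → K) (k : K) (w : List V) :
    spl (fun a b => k * F a b) w = k * spl F w :=
  (map_spl (AddMonoidHom.mulLeft k) F w).symm

theorem splL_mul_left (F : List V → V → List V → K) (k : K) (w : List V) :
    splL (fun a z b => k * F a z b) w = k * splL F w :=
  (map_splL (AddMonoidHom.mulLeft k) F w).symm

theorem sh_mul_right (F : List V → K) (k : K) (x y : List V) :
    sh (fun w => F w * k) x y = sh F x y * k :=
  (map_sh (AddMonoidHom.mulRight k) F x y).symm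

theorem sh_mul_left (F : List V → K) (k : K) (x y : List V) :
    sh (fun w => k * F w) x y = k * sh F x y :=
  (map_sh (AddMonoidHom.mulLeft k) F x y).symm

theorem spl_neg (F : List V → List V → K) (w : List V) :
    spl (fun a b => - F a b) w = - spl F w :=
  (map_spl (negAddMonoidHom) F w).symm

theorem spl_sub (F G : List V → List V → K) (w : List V) :
    spl (fun a b => F a b - G a b) w = spl F w - spl G w := by
  simp only [sub_eq_add_neg, spl_add, spl_neg]

theorem splL_neg (F : List V → V → List V → K) (w : List V) :
    splL (fun a z b => - F a z b) w = - splL F w :=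
  (map_splL (negAddMonoidHom) F w).symm

theorem splL_sub (F G : List V → V → List V → K) (w : List V) :
    splL (fun a z b => F a z b - G a z b) w = splL F w - splL G w := by
  simp only [sub_eq_add_neg, splL_add, splL_neg]

theorem sh_neg (F : List V → K) (x y : List V) :
    sh (fun w => - F w) x y = - sh F x y :=
  (map_sh (negAddMonoidHom) F x y).symm

theorem sh_sub (F G : List V → K) (x y : List V) :
    sh (fun w => F w - G w) x y = sh F x y - sh G x y := by
  simp only [sub_eq_add_neg, sh_add, sh_neg]

/-- The counit: the indicator function of the empty word. -/
def eps (w : List V) : K := if w.isEmpty then 1 else 0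

@[simp] theorem eps_nil : eps ([] : List V) = (1 : K) := rfl

@[simp] theorem eps_cons (z : V) (w : List V) : eps (z :: w) = (0 : K) := rfl

@[simp] theorem eps_append_singleton (w : List V) (z : V) : eps (w ++ [z]) = (0 : K) := by
  cases w <;> rfl

theorem spl_eps_left (F : List V → List V → K) (w : List V) :
    spl (fun a b => F a b * eps a) w = F [] w := by
  rw [spl_eq_nil_left]
  simp

theorem spl_eps_right (F : List V → List V → K) (w : List V) :
    spl (fun a b => F a b * eps b) w = F w [] := by
  rw [spl_eq_nil_right]
  simp

/-- A function on words is alternal if it vanishes on the empty word and on all shuffles of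
nonempty words. -/
structure IsAlt (A : List V → K) : Prop where
  nil : A [] = 0
  sh_eq_zero : ∀ x y : List V, x ≠ [] → y ≠ [] → sh A x y = 0

theorem IsAlt.sh_eq {A : List V → K} (hA : IsAlt A) (x y : List V) :
    sh A x y = A y * eps x + A x * eps y := by
  cases x with
  | nil => cases y <;> simp [hA.nil]
  | cons a x =>
    cases y with
    | nil => simp
    | cons b y => simp [hA.sh_eq_zero]

/-- The product `mu` of functions on words. -/
def muF (A B : List V → K) (w : List V) : K := spl (fun a b => A a * B b) w

/-- After deconcatenation each alternal factor must take its letters from a single word. The terms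
not containing `eps` are symmetric in A and B, so they disappear in lu. -/
theorem sh_muF {A B : List V → K} (hA : IsAlt A) (hB : IsAlt B) (x y : List V) :
    sh (muF A B) x y =
      A x * B y + A y * B x + muF A B x * eps y + muF A B y * eps x := by
  have h : sh (muF A B) x y = spl (fun x₁ x₂ => spl (fun y₁ y₂ =>
      (A y₁ * B y₂) * eps x₂ * eps x₁ + (A y₁ * B x₂) * eps y₂ * eps x₁ +
      ((A x₁ * B y₂) * eps y₁ * eps x₂ + (A x₁ * B x₂) * eps y₂ * eps y₁)) y) x := by
    refine (sh_spl _ x y).trans ?_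
    refine spl_congr fun x₁ x₂ _ => spl_congr fun y₁ y₂ _ => ?_
    simp only [sh_mul_left, sh_mul_right, hA.sh_eq, hB.sh_eq]
    ring
  rw [h]
  simp only [spl_add, spl_mul_right, spl_eps_left, spl_eps_right, muF]
  have e : ∀ w : List V, spl (fun a b => A a * B b * eps (K := K) b * eps a) w = 0 := by
    intro w; rw [spl_eps_left]; simp [hA.nil]
  ring

theorem IsAlt.lu {A B : List V → K} (hA : IsAlt A) (hB : IsAlt B) :
    IsAlt (fun w => muF A B w - muF B A w) := by
  refine ⟨by simp [muF, hA.nil], fun x y hx hy => ?_⟩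
  rw [sh_sub]
  erw [sh_muF hA hB, sh_muF hB hA]
  obtain ⟨a, x, rfl⟩ := List.exists_cons_of_ne_nil hx
  obtain ⟨b, y, rfl⟩ := List.exists_cons_of_ne_nil hy
  simp only [eps_cons]; ring

theorem IsAlt.add {A B : List V → K} (hA : IsAlt A) (hB : IsAlt B) :
    IsAlt (fun w => A w + B w) :=
  ⟨by simp [hA.nil, hB.nil], fun x y hx hy => by
    rw [sh_add, hA.sh_eq_zero x y hx hy, hB.sh_eq_zero x y hx hy, add_zero]⟩

theorem IsAlt.sub {A B : List V → K} (hA : IsAlt A) (hB : IsAlt B) :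
    IsAlt (fun w => A w - B w) :=
  ⟨by simp [hA.nil, hB.nil], fun x y hx hy => by
    rw [sh_sub, hA.sh_eq_zero x y hx hy, hB.sh_eq_zero x y hx hy, sub_zero]⟩

theorem IsAlt.comp_map {W : Type*} {A : List W → K} (hA : IsAlt A) (g : V → W) :
    IsAlt (fun w => A (w.map g)) :=
  ⟨hA.nil, fun x y hx hy => by
    rw [← sh_map, hA.sh_eq_zero _ _ (by simpa using hx) (by simpa using hy)]⟩

theorem IsAlt.comp_reverse {A : List V → K} (hA : IsAlt A) :
    IsAlt (fun w => A w.reverse) :=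
  ⟨hA.nil, fun x y hx hy => by
    rw [← sh_reverse, hA.sh_eq_zero _ _ (by simpa using hx) (by simpa using hy)]⟩

/-- The vanishing shuffle of zx with by splits by first letter: the part starting with z is minus
the part starting with b, to which induction applies. The case of empty x is the reversal rule of
alternal functions. -/
theorem IsAlt.sh_reverse_cons {A : List V → K} (hA : IsAlt A) (x y : List V) (z : V) :
    sh (fun w => A (z :: w)) x y = (-1) ^ y.length * A ((z :: y).reverse ++ x) := by
  induction y generalizing x z with
  | nil =>
    cases x with
    | nil => simp
    | cons a x => simp
  | cons b y ih =>
    have h := hA.sh_eq_zero (z :: x) (b :: y) (by simp) (by simp)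
    rw [sh_cons_cons, ih] at h
    rw [eq_neg_of_add_eq_zero_left h]
    simp [pow_succ]

theorem IsAlt.reverse {A : List V → K} (hA : IsAlt A) (y : List V) (z : V) :
    A (z :: y).reverse = (-1) ^ y.length * A (z :: y) := by
  have h := hA.sh_reverse_cons [] y z
  rw [sh_nil_left, List.append_nil] at h
  rw [h, ← mul_assoc, ← mul_pow]
  simp

/-- The operator on functions on words that sums over the insertions of factors next to
letters. -/
def ins (h : V → List V → K) (φ : V → List V → V) (A : List V → K) (w : List V) : K :=
  splL (fun s z c => spl (fun a b => A (a ++ φ z b :: c) * h z b) s) w -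
    splL (fun a z s => spl (fun b c => A (a ++ φ z b :: c) * h z b) s) w

section Insertion

variable {h : V → List V → K} {φ : V → List V → V} (A : List V → K)

/-- Insertions where the removed factor and the letter next to it belong to different words. -/
def cross (h : V → List V → K) (φ : V → List V → V) (A : List V → K) (x y : List V) : K :=
  splL (fun x₁ z x₂ => spl (fun y₁ t => spl (fun b y₂ =>
    sh (fun a => sh (fun c => A (a ++ φ z b :: c)) x₂ y₂) x₁ y₁ * h z b) t) y) x

/-- The merged letter does not depend on the order within the removed factor, so it comes out of the
middle shuffle; alternality of `h z` then leaves only factors lying in one of the two words. -/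
theorem sh_mid (hh : ∀ z, IsAlt (h z)) (hφ : ∀ z b b', b.Perm b' → φ z b = φ z b')
    (z : V) (x₁ x₂ x₃ y₁ y₂ y₃ : List V) :
    sh (fun a => sh (fun b => sh (fun c => A (a ++ φ z b :: c) * h z b) x₃ y₃) x₂ y₂) x₁ y₁ =
      sh (fun a => sh (fun c => A (a ++ φ z (x₂ ++ y₂) :: c)) x₃ y₃) x₁ y₁ *
        (h z y₂ * eps x₂ + h z x₂ * eps y₂) := by
  rw [← (hh z).sh_eq, ← sh_mul_right]
  refine sh_congr fun a _ => ?_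
  rw [← sh_mul_left]
  refine sh_congr fun b hb => ?_
  rw [sh_mul_right, hφ z _ _ hb]

/-- The letter z and the factor b each come from x or from y. Different origins give the `cross`
terms; equal origins rebuild a shuffle of a contracted word with the other word. -/
theorem sh_ins_left (hh : ∀ z, IsAlt (h z)) (hφ : ∀ z b b', b.Perm b' → φ z b = φ z b')
    (x y : List V) :
    sh (splL (fun s z c => spl (fun a b => A (a ++ φ z b :: c) * h z b) s)) x y =
      cross h φ A x y + cross h φ A y x +
      splL (fun s z c => spl (fun a b => sh A (a ++ φ z b :: c) y * h z b) s) x +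
      splL (fun s z c => spl (fun a b => sh A (a ++ φ z b :: c) x * h z b) s) y := by
  have key : ∀ (z : V) (x₁ x₂ y₁ y₂ : List V),
      sh (fun s => sh (fun c => spl (fun a b => A (a ++ φ z b :: c) * h z b) s) x₂ y₂) x₁ y₁ =
      spl (fun y₁ b => sh (fun a => sh (fun c => A (a ++ φ z b :: c)) x₂ y₂) x₁ y₁ * h z b) y₁ +
      spl (fun x₁ b => sh (fun a => sh (fun c => A (a ++ φ z b :: c)) x₂ y₂) x₁ y₁ * h z b)
        x₁ := by
    intro z x₁ x₂ y₁ y₂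
    simp only [sh_spl_comm]
    refine (sh_spl _ x₁ y₁).trans ?_
    simp only [sh_mid A hh hφ, mul_add, spl_add, ← mul_assoc, spl_mul_right, spl_eps_right,
      List.nil_append, List.append_nil]
  rw [sh_splL]
  simp only [key, spl_add, splL_add]
  have comm : ∀ (z : V) (b x₁ x₂ y₁ y₂ : List V),
      sh (fun a => sh (fun c => A (a ++ φ z b :: c)) x₂ y₂) x₁ y₁ =
      sh (fun a => sh (fun c => A (a ++ φ z b :: c)) y₂ x₂) y₁ x₁ := by
    intro z b x₁ x₂ y₁ y₂
    rw [sh_comm]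
    simp only [sh_comm _ x₂ y₂]
  have e1 : ∀ x y : List V, splL (fun x₁ z x₂ => spl (fun s y₂ => spl (fun y₁ b =>
      sh (fun a => sh (fun c => A (a ++ φ z b :: c)) x₂ y₂) x₁ y₁ * h z b) s) y) x =
      cross h φ A x y := by
    intro x y
    refine splL_congr fun x₁ z x₂ _ => ?_
    exact spl_assoc (fun y₁ b y₂ =>
      sh (fun a => sh (fun c => A (a ++ φ z b :: c)) x₂ y₂) x₁ y₁ * h z b) y
  have e2 : ∀ x y : List V, splL (fun s z x₂ => spl (fun y₁ y₂ => spl (fun x₁ b =>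
      sh (fun a => sh (fun c => A (a ++ φ z b :: c)) x₂ y₂) x₁ y₁ * h z b) s) y) x =
      splL (fun s z c => spl (fun a b => sh A (a ++ φ z b :: c) y * h z b) s) x := by
    intro x y
    refine splL_congr fun s z x₂ _ => ?_
    rw [spl_comm]
    simp only [spl_mul_right, sh_append_cons]
  have e1' : splL (fun y₁ z y₂ => spl (fun s x₂ => spl (fun x₁ b =>
      sh (fun a => sh (fun c => A (a ++ φ z b :: c)) x₂ y₂) x₁ y₁ * h z b) s) x) y =
      cross h φ A y x := by
    rw [← e1]
    refine splL_congr fun _ _ _ _ => spl_congr fun _ _ _ => spl_congr fun _ _ _ => ?_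
    rw [comm]
  have e2' : splL (fun s z y₂ => spl (fun x₁ x₂ => spl (fun y₁ b =>
      sh (fun a => sh (fun c => A (a ++ φ z b :: c)) x₂ y₂) x₁ y₁ * h z b) s) x) y =
      splL (fun s z c => spl (fun a b => sh A (a ++ φ z b :: c) x * h z b) s) y := by
    rw [← e2]
    refine splL_congr fun _ _ _ _ => spl_congr fun _ _ _ => spl_congr fun _ _ _ => ?_
    rw [comm]
  rw [e1, e2, e1', e2']
  abel

/-- When b and z come from different words, their relative order leaves no trace in `cross`, so the
cross terms are those of `sh_ins_left`. -/
theorem sh_ins_right (hh : ∀ z, IsAlt (h z)) (hφ : ∀ z b b', b.Perm b' → φ z b = φ z b')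
    (x y : List V) :
    sh (splL (fun a z s => spl (fun b c => A (a ++ φ z b :: c) * h z b) s)) x y =
      cross h φ A x y + cross h φ A y x +
      splL (fun a z s => spl (fun b c => sh A (a ++ φ z b :: c) y * h z b) s) x +
      splL (fun a z s => spl (fun b c => sh A (a ++ φ z b :: c) x * h z b) s) y := by
  have key : ∀ (z : V) (x₁ x₂ y₁ y₂ : List V),
      sh (fun a => sh (fun s => spl (fun b c => A (a ++ φ z b :: c) * h z b) s) x₂ y₂) x₁ y₁ =
      spl (fun b y₂ => sh (fun a => sh (fun c => A (a ++ φ z b :: c)) x₂ y₂) x₁ y₁ * h z b) y₂ +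
      spl (fun b x₂ => sh (fun a => sh (fun c => A (a ++ φ z b :: c)) x₂ y₂) x₁ y₁ * h z b)
        x₂ := by
    intro z x₁ x₂ y₁ y₂
    have e : ∀ a, sh (fun s => spl (fun b c => A (a ++ φ z b :: c) * h z b) s) x₂ y₂ = _ :=
      fun a => sh_spl _ x₂ y₂
    simp only [e, sh_spl_comm]
    simp only [sh_mid A hh hφ, mul_add, spl_add, ← mul_assoc, spl_mul_right, spl_eps_left,
      List.nil_append, List.append_nil]
  rw [sh_splL]
  simp only [key, spl_add, splL_add]
  have comm : ∀ (z : V) (b x₁ x₂ y₁ y₂ : List V),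
      sh (fun a => sh (fun c => A (a ++ φ z b :: c)) x₂ y₂) x₁ y₁ =
      sh (fun a => sh (fun c => A (a ++ φ z b :: c)) y₂ x₂) y₁ x₁ := by
    intro z b x₁ x₂ y₁ y₂
    rw [sh_comm]
    simp only [sh_comm _ x₂ y₂]
  have e1 : ∀ x y : List V, splL (fun x₁ z x₂ => spl (fun y₁ s => spl (fun b y₂ =>
      sh (fun a => sh (fun c => A (a ++ φ z b :: c)) x₂ y₂) x₁ y₁ * h z b) s) y) x =
      cross h φ A x y := fun _ _ => rfl
  have e2 : ∀ x y : List V, splL (fun x₁ z s => spl (fun y₁ y₂ => spl (fun b x₂ =>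
      sh (fun a => sh (fun c => A (a ++ φ z b :: c)) x₂ y₂) x₁ y₁ * h z b) s) y) x =
      splL (fun a z s => spl (fun b c => sh A (a ++ φ z b :: c) y * h z b) s) x := by
    intro x y
    refine splL_congr fun s z x₂ _ => ?_
    rw [spl_comm]
    simp only [spl_mul_right, sh_append_cons]
  have e1' : splL (fun y₁ z y₂ => spl (fun x₁ s => spl (fun b x₂ =>
      sh (fun a => sh (fun c => A (a ++ φ z b :: c)) x₂ y₂) x₁ y₁ * h z b) s) x) y =
      cross h φ A y x := by
    rw [← e1]
    refine splL_congr fun _ _ _ _ => spl_congr fun _ _ _ => spl_congr fun _ _ _ => ?_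
    rw [comm]
  have e2' : splL (fun y₁ z s => spl (fun x₁ x₂ => spl (fun b y₂ =>
      sh (fun a => sh (fun c => A (a ++ φ z b :: c)) x₂ y₂) x₁ y₁ * h z b) s) x) y =
      splL (fun a z s => spl (fun b c => sh A (a ++ φ z b :: c) x * h z b) s) y := by
    rw [← e2]
    refine splL_congr fun _ _ _ _ => spl_congr fun _ _ _ => spl_congr fun _ _ _ => ?_
    rw [comm]
  rw [e1, e2, e1', e2']
  abel

variable {A}

/-- Inserting alternal factors next to letters preserves alternality. -/
theorem IsAlt.ins (hA : IsAlt A) (hh : ∀ z, IsAlt (h z))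
    (hφ : ∀ z b b', b.Perm b' → φ z b = φ z b') : IsAlt (ins h φ A) := by
  refine ⟨by simp [WordSum.ins], fun x y hx hy => ?_⟩
  have e : ∀ (a c : List V) (z : V) (w : List V), w ≠ [] → sh A (a ++ z :: c) w = 0 :=
    fun a c z w hw => hA.sh_eq_zero _ _ (by simp) hw
  have h1 := sh_ins_left A hh hφ x y
  have h2 := sh_ins_right A hh hφ x y
  simp only [e _ _ _ _ hx, e _ _ _ _ hy, zero_mul, spl_zero, splL_zero, add_zero] at h1 h2
  refine (sh_sub _ _ x y).trans ?_
  exact (congrArg₂ (· - ·) h1 h2).trans (sub_self _)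

end Insertion
end Alternal
end WordSum

/-! ### The ari-bracket on functions on words -/

namespace WordSum

section Bilinear

variable {V K : Type*} [CommRing K]

theorem ins_add (h : V → List V → K) (φ : V → List V → V) (A B : List V → K) :
    ins h φ (A + B) = ins h φ A + ins h φ B := by
  funext w; simp only [ins, Pi.add_apply, add_mul, spl_add, splL_add]; ring

theorem muF_add_right (A B C : List V → K) : muF C (A + B) = muF C A + muF C B := by
  funext w; simp only [muF, Pi.add_apply, mul_add, spl_add]

theorem muF_smul_right (k : K) (A C : List V → K) : muF C (k • A) = k • muF C A := by
  funext w
  simp only [muF, Pi.smul_apply, smul_eq_mul, mul_left_comm _ k, spl_mul_left]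

theorem muF_add_left (A B C : List V → K) : muF (A + B) C = muF A C + muF B C := by
  funext w; simp only [muF, Pi.add_apply, add_mul, spl_add]

theorem muF_smul_left (k : K) (A C : List V → K) : muF (k • A) C = k • muF A C := by
  funext w
  simp only [muF, Pi.smul_apply, smul_eq_mul, mul_assoc, spl_mul_left]

theorem muF_assoc (A B C : List V → K) : muF (muF A B) C = muF A (muF B C) := by
  funext w
  simp only [muF, ← spl_mul_right, ← spl_mul_left]
  rw [spl_assoc]
  simp only [mul_assoc]

end Bilinear

section Ari

variable {V K : Type*} [AddCommGroup V] [CommRing K]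

/-- The operator `arit(B)` on functions on words. -/
def aritF (B A : List V → K) : List V → K := ins (fun _ => B) (fun z b => z + b.sum) A

/-- The ari-bracket of functions on words. -/
def ariF (A B : List V → K) (w : List V) : K :=
  aritF B A w - aritF A B w + (muF A B w - muF B A w)

theorem IsAlt.ariF {A B : List V → K} (hA : IsAlt A) (hB : IsAlt B) : IsAlt (ariF A B) :=
  ((hA.ins (fun _ => hB) fun _ _ _ h => by rw [h.sum_eq]).sub
    (hB.ins (fun _ => hA) fun _ _ _ h => by rw [h.sum_eq])).add (hA.lu hB)

/-! #### The Jacobi identity -/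

/-- The coderivation with corestriction `f ↦ γ(f) · (∑ f)`, acting on functions on words. -/
def der (γ A : List V → K) (w : List V) : K :=
  spl (fun a t => spl (fun f c => A (a ++ f.sum :: c) * γ f) t) w

/-- The difference between the values at a word without its last and without its first letter. -/
def flank (B : List V → K) (f : List V) : K := B f.dropLast - B f.tail

/-- A removed factor together with its absorbing letter is one nonempty factor f, replaced by its
sum. The removed part is f without its last letter or f without its first letter, according to the
side. -/
theorem aritF_eq_der {B : List V → K} (hB : B [] = 0) (A : List V → K) :
    aritF B A = der (flank B) A := by
  funext w
  have h1 := spl_append_left (fun a f c => A (a ++ f.sum :: c) * B f.dropLast)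
    (by simp [hB]) w
  have h2 := spl_append_right (fun a f c => A (a ++ f.sum :: c) * B f.tail) (by simp [hB]) w
  simp only [List.dropLast_concat, List.tail_cons, List.sum_append, List.sum_cons,
    List.sum_nil, add_zero] at h1 h2
  simp only [der, flank, mul_sub, spl_sub, ← h1, ← h2, aritF, ins, add_comm]

theorem der_sub_left (γ δ A : List V → K) : der (γ - δ) A = der γ A - der δ A := by
  funext w; simp only [der, Pi.sub_apply, mul_sub, spl_sub]

/-- The part of a composition of two coderivations that acts on two disjoint factors. -/
def disj (γ δ A : List V → K) (w : List V) : K :=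
  spl (fun a r => spl (fun f s => spl (fun b t => spl (fun g c =>
    A (a ++ f.sum :: (b ++ g.sum :: c)) * δ g * γ f) t) s) r) w

/-- The factor contracted by δ either contains the letter created by γ, giving the nested term, or
lies entirely after it or before it, giving the two disjoint terms. -/
theorem der_der (γ δ A : List V → K) (w : List V) :
    der γ (der δ A) w = der (der γ δ) A w + disj γ δ A w + disj δ γ A w := by
  have h1 : der γ (der δ A) w = spl (fun a t => spl (fun f c =>
      (spl (fun a₁ a₂ => spl (fun g a₃ => A (a₁ ++ g.sum :: (a₃ ++ f.sum :: c)) * δ g * γ f) a₂) a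
      + spl (fun a₁ a₂ => spl (fun c₁ c₂ => A (a₁ ++ (a₂ ++ f.sum :: c₁).sum :: c₂) *
          δ (a₂ ++ f.sum :: c₁) * γ f) c) a)
      + spl (fun b t => spl (fun g c =>
          A (a ++ f.sum :: (b ++ g.sum :: c)) * δ g * γ f) t) c) t) w := by
    refine spl_congr fun a t _ => spl_congr fun f c _ => ?_
    simp only [der, spl_append_cons, ← spl_mul_right, spl_add, add_mul, List.append_assoc,
      List.cons_append]
  have h2 : spl (fun a t => spl (fun f c =>
      spl (fun a₁ a₂ => spl (fun g a₃ => A (a₁ ++ g.sum :: (a₃ ++ f.sum :: c)) * δ g * γ f) a₂) a)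
      t) w = disj δ γ A w := by
    calc _ = spl (fun a t => spl (fun a₁ a₂ => spl (fun f c =>
        spl (fun g a₃ => A (a₁ ++ g.sum :: (a₃ ++ f.sum :: c)) * δ g * γ f) a₂) t) a) w :=
          spl_congr fun a t _ => spl_comm _ _ _
      _ = spl (fun a₁ s => spl (fun a₂ t => spl (fun f c => spl (fun g a₃ =>
          A (a₁ ++ g.sum :: (a₃ ++ f.sum :: c)) * δ g * γ f) a₂) t) s) w := spl_assoc _ w
      _ = spl (fun a₁ s => spl (fun a₂ t => spl (fun g a₃ => spl (fun f c =>
          A (a₁ ++ g.sum :: (a₃ ++ f.sum :: c)) * δ g * γ f) t) a₂) s) w :=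
          spl_congr fun _ _ _ => spl_congr fun _ _ _ => spl_comm _ _ _
      _ = spl (fun a₁ s => spl (fun g q => spl (fun a₃ t => spl (fun f c =>
          A (a₁ ++ g.sum :: (a₃ ++ f.sum :: c)) * δ g * γ f) t) q) s) w :=
          spl_congr fun _ s _ => spl_assoc _ s
      _ = _ := by simp only [disj, mul_right_comm]
  have h3 : spl (fun a t => spl (fun f c =>
      spl (fun a₁ a₂ => spl (fun c₁ c₂ => A (a₁ ++ (a₂ ++ f.sum :: c₁).sum :: c₂) *
          δ (a₂ ++ f.sum :: c₁) * γ f) c) a) t) w = der (der γ δ) A w := by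
    calc _ = spl (fun a t => spl (fun a₁ a₂ => spl (fun f c =>
          spl (fun c₁ c₂ => A (a₁ ++ (a₂ ++ f.sum :: c₁).sum :: c₂) *
          δ (a₂ ++ f.sum :: c₁) * γ f) c) t) a) w := spl_congr fun a t _ => spl_comm _ _ _
      _ = spl (fun a₁ s => spl (fun a₂ t => spl (fun f c =>
          spl (fun c₁ c₂ => A (a₁ ++ (a₂ ++ f.sum :: c₁).sum :: c₂) *
          δ (a₂ ++ f.sum :: c₁) * γ f) c) t) s) w := spl_assoc _ w
      _ = spl (fun a₁ s => spl (fun a₂ t => spl (fun r c₂ =>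
          spl (fun f c₁ => A (a₁ ++ (a₂ ++ f.sum :: c₁).sum :: c₂) *
          δ (a₂ ++ f.sum :: c₁) * γ f) r) t) s) w :=
          spl_congr fun _ _ _ => spl_congr fun _ t _ => (spl_assoc _ t).symm
      _ = spl (fun a₁ s => spl (fun g c₂ => spl (fun a₂ r =>
          spl (fun f c₁ => A (a₁ ++ (a₂ ++ f.sum :: c₁).sum :: c₂) *
          δ (a₂ ++ f.sum :: c₁) * γ f) r) g) s) w :=
          spl_congr fun _ s _ => (spl_assoc _ s).symm
      _ = _ := by
        refine spl_congr fun a₁ s _ => spl_congr fun g c₂ _ => ?_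
        simp only [der, ← spl_mul_left]
        refine spl_congr fun a₂ r hg => spl_congr fun f c₁ hr => ?_
        subst hg hr
        simp only [List.sum_append, List.sum_cons, mul_assoc]
  rw [h1]
  simp only [spl_add]
  rw [h2, h3]
  simp only [disj]
  abel

/-- The disjoint terms are symmetric in γ and δ, so only the nested ones survive in the commutator.
-/
theorem der_der_sub (γ δ A : List V → K) :
    der γ (der δ A) - der δ (der γ A) = der (der γ δ - der δ γ) A := by
  funext w
  simp only [der_sub_left, Pi.sub_apply, der_der]
  abel

theorem der_muF (γ A B : List V → K) : der γ (muF A B) = muF (der γ A) B + muF A (der γ B) := by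
  funext w
  have h1 : der γ (muF A B) w = spl (fun a t => spl (fun f c =>
      (spl (fun a₁ a₂ => A a₁ * (B (a₂ ++ f.sum :: c) * γ f)) a
      + spl (fun c₁ c₂ => A (a ++ f.sum :: c₁) * γ f * B c₂) c)) t) w := by
    refine spl_congr fun a t _ => spl_congr fun f c _ => ?_
    simp only [muF, spl_append_cons, ← spl_mul_right, add_mul, mul_assoc, mul_comm (γ f)]
  have h2 : spl (fun a t => spl (fun f c =>
      spl (fun c₁ c₂ => A (a ++ f.sum :: c₁) * γ f * B c₂) c) t) w = muF (der γ A) B w := by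
    calc _ = spl (fun a t => spl (fun s c₂ => spl (fun f c₁ =>
          A (a ++ f.sum :: c₁) * γ f * B c₂) s) t) w :=
          spl_congr fun _ t _ => (spl_assoc _ t).symm
      _ = spl (fun s c₂ => spl (fun a t => spl (fun f c₁ =>
          A (a ++ f.sum :: c₁) * γ f * B c₂) t) s) w := (spl_assoc _ w).symm
      _ = _ := by simp only [spl_mul_right]; rfl
  have h3 : spl (fun a t => spl (fun f c =>
      spl (fun a₁ a₂ => A a₁ * (B (a₂ ++ f.sum :: c) * γ f)) a) t) w = muF A (der γ B) w := by
    calc _ = spl (fun a t => spl (fun a₁ a₂ => spl (fun f c =>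
          A a₁ * (B (a₂ ++ f.sum :: c) * γ f)) t) a) w := spl_congr fun _ t _ => spl_comm _ _ _
      _ = spl (fun a₁ s => spl (fun a₂ t => spl (fun f c =>
          A a₁ * (B (a₂ ++ f.sum :: c) * γ f)) t) s) w := spl_assoc _ w
      _ = _ := by simp only [spl_mul_left]; rfl
  rw [h1]
  simp only [spl_add]
  rw [h2, h3, Pi.add_apply, add_comm]

/-- Deleting the last (first) letter commutes with a contraction unless the contracted factor
reaches that end of t; these boundary factors produce the products `muF` and the sums over t = azb.
-/
theorem der_flank {B C : List V → K} (hC : C [] = 0) (t : List V) (x y : V) (i m : List V)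
    (hi : t = i ++ [y]) (hm : t = x :: m) :
    der (flank C) (flank B) t =
      aritF C B i - aritF C B m + muF B C i + muF C B m
        - splL (fun a _ b => B a * C b) t - splL (fun a _ b => C a * B b) t := by
  have e1 : spl (fun a s => spl (fun f c => B (a ++ f.sum :: c).dropLast * flank C f) s) t =
      aritF C B i + muF B C i - splL (fun a _ b => B a * C b) t := by
    rw [← spl_assoc, hi, spl_append_singleton]
    have h : ∀ a b : List V, (a ++ b.sum :: ([] : List V)).dropLast = a := by simp
    have h' : ∀ (a b c : List V) , (a ++ b.sum :: (c ++ [y])).dropLast = a ++ b.sum :: c := by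
      intro a b c
      rw [← List.cons_append, ← List.append_assoc, List.dropLast_concat]
    simp only [h, h', aritF_eq_der hC]
    rw [spl_assoc, add_sub_assoc]
    congr 1
    simp only [flank, mul_sub, spl_sub]
    congr 1
    · rw [spl_append_singleton]
      simp [muF, hC]
    · rw [spl_eq_nil_right]
      simp [hC]
  have e2 : spl (fun a s => spl (fun f c => B (a ++ f.sum :: c).tail * flank C f) s) t =
      aritF C B m - muF C B m + splL (fun a _ b => C a * B b) t := by
    rw [hm, spl_cons]
    simp only [List.nil_append, List.cons_append, List.tail_cons, aritF_eq_der hC]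
    rw [sub_add_eq_add_sub, add_comm, add_sub_assoc]
    congr 1
    simp only [flank, mul_sub, spl_sub]
    congr 1
    · rw [spl_eq_nil_left]
      simp [hC, mul_comm]
    · rw [spl_cons]
      simp [hC, muF, mul_comm]
  have e3 : der (flank C) (flank B) t =
      spl (fun a s => spl (fun f c => B (a ++ f.sum :: c).dropLast * flank C f) s) t -
      spl (fun a s => spl (fun f c => B (a ++ f.sum :: c).tail * flank C f) s) t := by
    rw [← spl_sub]
    simp only [← spl_sub, ← sub_mul]
    rfl
  rw [e3, e1, e2]
  ring

/-- In `der_flank` the sums over t = azb are symmetric in B and C and cancel; the remaining boundary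
products are the lu part of the ari-bracket. -/
theorem der_flank_sub {B C : List V → K} (hB : B [] = 0) (hC : C [] = 0) :
    der (flank C) (flank B) - der (flank B) (flank C) = flank (ariF B C) := by
  funext t
  rcases t with _ | ⟨x, m⟩
  · simp [der, flank]
  · obtain ⟨i, y, hi⟩ : ∃ i y, x :: m = i ++ [y] :=
      ⟨_, _, (List.dropLast_append_getLast (List.cons_ne_nil x m)).symm⟩
    rw [Pi.sub_apply, der_flank hC _ x y i m hi rfl, der_flank hB _ x y i m hi rfl]
    have h1 : flank (ariF B C) (x :: m) = ariF B C i - ariF B C m := by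
      rw [flank, List.tail_cons, hi, List.dropLast_concat]
    rw [h1, ariF, ariF]
    ring

theorem ariF_nil {A B : List V → K} (hA : A [] = 0) : ariF A B [] = 0 := by
  simp [ariF, aritF, ins, muF, hA]

theorem aritF_ariF {A B C : List V → K} (hB : B [] = 0) (hC : C [] = 0) :
    aritF (ariF B C) A = aritF C (aritF B A) - aritF B (aritF C A) := by
  rw [aritF_eq_der (ariF_nil hB), ← der_flank_sub hB hC, ← der_der_sub]
  simp only [aritF_eq_der hB, aritF_eq_der hC]

theorem aritF_add_right (A B C : List V → K) : aritF C (A + B) = aritF C A + aritF C B :=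
  ins_add _ _ _ _

theorem aritF_smul_right (k : K) (A C : List V → K) : aritF C (k • A) = k • aritF C A := by
  funext w
  simp only [aritF, ins, Pi.smul_apply, smul_eq_mul, mul_assoc, spl_mul_left, splL_mul_left]
  ring

theorem aritF_add_left (A B C : List V → K) : aritF (A + B) C = aritF A C + aritF B C := by
  funext w; simp only [aritF, ins, Pi.add_apply, mul_add, spl_add, splL_add]; ring

theorem aritF_smul_left (k : K) (A C : List V → K) : aritF (k • A) C = k • aritF A C := by
  funext w
  simp only [aritF, ins, Pi.smul_apply, smul_eq_mul, mul_left_comm _ k, spl_mul_left,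
    splL_mul_left]
  ring

theorem ariF_eq (A B : List V → K) :
    ariF A B = aritF B A + (-1 : K) • aritF A B + (muF A B + (-1 : K) • muF B A) := by
  funext w
  simp [ariF, sub_eq_add_neg]

theorem ariF_add_right (A B C : List V → K) : ariF C (A + B) = ariF C A + ariF C B := by
  simp only [ariF_eq, aritF_add_left, aritF_add_right, muF_add_left, muF_add_right, smul_add]
  abel

theorem ariF_add_left (A B C : List V → K) : ariF (A + B) C = ariF A C + ariF B C := by
  simp only [ariF_eq, aritF_add_left, aritF_add_right, muF_add_left, muF_add_right, smul_add]
  abel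

theorem ariF_smul_right (k : K) (A C : List V → K) : ariF C (k • A) = k • ariF C A := by
  simp only [ariF_eq, aritF_smul_left, aritF_smul_right, muF_smul_left, muF_smul_right, smul_add,
    smul_comm k (-1 : K)]

theorem ariF_self (A : List V → K) : ariF A A = 0 := by
  funext w; simp [ariF]

theorem ariF_jacobi {A B C : List V → K} (hA : A [] = 0) (hB : B [] = 0) (hC : C [] = 0) :
    ariF A (ariF B C) = ariF (ariF A B) C + ariF B (ariF A C) := by
  have d : ∀ {D : List V → K} (_ : D [] = 0) (E F : List V → K),
      aritF D (muF E F) = muF (aritF D E) F + muF E (aritF D F) := by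
    intro D hD E F
    rw [aritF_eq_der hD, der_muF]
    simp only [aritF_eq_der hD]
  -- Only the outer brackets are expanded first, so that arit of an inner bracket can be replaced by
  -- a commutator.
  rw [ariF_eq A (ariF B C), ariF_eq (ariF A B) C, ariF_eq B (ariF A C), aritF_ariF hB hC,
    aritF_ariF hA hB, aritF_ariF hA hC]
  simp only [ariF_eq, aritF_add_right, aritF_smul_right, muF_add_left, muF_add_right,
    muF_smul_left, muF_smul_right, d hA, d hB, d hC, muF_assoc, smul_add]
  module

end Ari
end WordSum

/-! ### Words as successive differences of points -/

namespace WordSum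

section Last

variable {V : Type*}

/-- The last letter of the sequence `p, q₁, …, q_r`. -/
def lst : V → List V → V
  | p, [] => p
  | _, q :: w => lst q w

@[simp] theorem lst_nil (p : V) : lst p [] = p := rfl

@[simp] theorem lst_cons (p q : V) (w : List V) : lst p (q :: w) = lst q w := rfl

theorem lst_append (p : V) (s t : List V) : lst p (s ++ t) = lst (lst p s) t := by
  induction s generalizing p with
  | nil => rfl
  | cons q s ih => simp [ih]

end Last

section Points

variable {V K : Type*} [AddCommGroup V]

/-- The successive differences of the sequence `p, q₁, …, q_r`. -/
def dif : V → List V → List V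
  | _, [] => []
  | p, q :: w => (q - p) :: dif q w

@[simp] theorem dif_nil (p : V) : dif p [] = [] := rfl

@[simp] theorem dif_cons (p q : V) (w : List V) : dif p (q :: w) = (q - p) :: dif q w := rfl

@[simp] theorem length_dif (p : V) (w : List V) : (dif p w).length = w.length := by
  induction w generalizing p with
  | nil => rfl
  | cons q w ih => simp [ih]

theorem dif_append (p : V) (s t : List V) : dif p (s ++ t) = dif p s ++ dif (lst p s) t := by
  induction s generalizing p with
  | nil => rfl
  | cons q s ih => simp [ih]

theorem sum_dif (p : V) (w : List V) : (dif p w).sum = lst p w - p := by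
  induction w generalizing p with
  | nil => simp
  | cons q w ih => simp [ih]

theorem dif_map_neg (p : V) (w : List V) :
    dif (-p) (w.map (-·)) = (dif p w).map (-·) := by
  induction w generalizing p with
  | nil => rfl
  | cons q w ih => simp [ih, neg_add_eq_sub]

theorem dif_map_sub (p z : V) (w : List V) : dif (p - z) (w.map (· - z)) = dif p w := by
  induction w generalizing p with
  | nil => rfl
  | cons q w ih => simp [ih]

theorem dif_reverse (p q : V) (w : List V) :
    dif p (q :: w).reverse = ((dif q (w ++ [p])).map (-·)).reverse := by
  induction w generalizing q with
  | nil => simp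
  | cons r w ih =>
    have hl : lst p (r :: w).reverse = r := by simp [lst_append]
    rw [List.reverse_cons, dif_append, ih, hl]
    simp

theorem exists_dif_eq (p : V) (w : List V) : ∃ v, dif p v = w := by
  induction w generalizing p with
  | nil => exact ⟨[], rfl⟩
  | cons z w ih =>
    obtain ⟨v, hv⟩ := ih (z + p)
    exact ⟨(z + p) :: v, by simp [hv]⟩

theorem spl_dif [AddCommMonoid K] (F : List V → List V → K) (p : V) (w : List V) :
    spl F (dif p w) = spl (fun s t => F (dif p s) (dif (lst p s) t)) w := by
  induction w generalizing p F with
  | nil => rfl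
  | cons q w ih => simp [spl_cons, ih]

theorem splL_dif [AddCommMonoid K] (F : List V → V → List V → K) (p : V) (w : List V) :
    splL F (dif p w) = splL (fun s q t => F (dif p s) (q - lst p s) (dif q t)) w := by
  induction w generalizing p F with
  | nil => rfl
  | cons q w ih => simp [splL_cons, ih]

/-! #### The ari-bracket in terms of partial sums -/

section Swap

variable [CommRing K]

/-- `A` is invariant under cyclic permutations of the sequences whose differences are its
arguments. -/
def IsPushInv (A : List V → K) : Prop :=
  ∀ (p : V) (w : List V) (y : V), A (dif p (w ++ [y])) = A (dif y (p :: w))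

/-- In terms of points a contraction is a deletion, so the merged letter becomes φ z b = z while B
depends on the base point z; this is why `ins` allows h to depend on the letter. The mu terms
account for factors at the ends of the word. -/
theorem aritF_dif {A B : List V → K} (hB : B [] = 0) (hpush : IsPushInv B)
    (p : V) (w : List V) :
    aritF B A (dif p w) + muF A B (dif p w) =
      muF (fun w => B (dif p w)) (fun w => A (dif p w)) w -
        ins (fun z b => B (dif z b)) (fun z _ => z) (fun w => A (dif p w)) w := by
  have hR : splL (fun s z c => spl (fun a b => A (a ++ (z + b.sum) :: c) * B b) s) (dif p w) +
      muF A B (dif p w) = muF (fun w => B (dif p w)) (fun w => A (dif p w)) w +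
        splL (fun a z s => spl (fun b c => A (dif p (a ++ z :: c)) * B (dif z b)) s) w := by
    have h1 : splL (fun s z c => spl (fun a b => A (a ++ (z + b.sum) :: c) * B b) s) (dif p w) =
        spl (fun a r => splL (fun b q t => A (dif p (a ++ q :: t)) * B (dif (lst p a) b)) r) w := by
      rw [splL_dif, ← splL_spl]
      refine splL_congr fun s q t _ => ?_
      rw [spl_dif]
      refine spl_congr fun a b hs => ?_
      rw [sum_dif, hs, lst_append, dif_append]
      simp
    have h2 : muF A B (dif p w) =
        spl (fun a r => A (dif p (a ++ [])) * B (dif (lst p a) r)) w := by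
      rw [muF, spl_dif]
      simp only [List.append_nil]
    have h3 : ∀ a r : List V, splL (fun b q t => A (dif p (a ++ q :: t)) * B (dif (lst p a) b)) r
        + A (dif p (a ++ [])) * B (dif (lst p a) r) =
        spl (fun b c => A (dif p (a ++ c)) * B (dif (lst p a) b)) r := by
      intro a r
      rw [spl_eq_nil_right, add_comm]
    rw [h1, h2, ← spl_add]
    simp only [h3]
    rw [spl_eq_nil_left]
    simp only [List.nil_append, lst_nil, lst_append, lst_cons, List.append_assoc,
      List.cons_append, muF, mul_comm]
  have hL : splL (fun a z s => spl (fun b c => A (a ++ (z + b.sum) :: c) * B b) s) (dif p w) =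
      splL (fun s z c => spl (fun a b => A (dif p (a ++ z :: c)) * B (dif z b)) s) w := by
    -- A right insertion deletes all points of f except the last. The same nonempty f is read once
    -- from its first point and once from its last.
    let H : List V → List V → List V → K := fun s f c => match f with
      | [] => 0
      | q :: b => A (dif p (s ++ lst q b :: c)) * B (dif q b)
    have h1 := spl_append_right H (fun _ _ => rfl) w
    rw [← spl_append_left H (fun _ _ => rfl) w] at h1
    refine Eq.trans ?_ (h1.trans ?_)
    · rw [splL_dif]
      refine splL_congr fun s q t _ => ?_
      rw [spl_dif]
      refine spl_congr fun b c _ => ?_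
      change _ = A (dif p (s ++ lst q b :: c)) * B (dif q b)
      rw [sum_dif, dif_append]
      simp
    · refine splL_congr fun s z c _ => spl_congr fun a b _ => ?_
      cases b with
      | nil => simp [H, hB]
      | cons q b =>
        change A (dif p (a ++ lst q (b ++ [z]) :: c)) * B (dif q (b ++ [z])) = _
        -- Push-invariance moves the base point of B from the first, deleted point to the last,
        -- retained one.
        rw [lst_append, hpush]
        rfl
  rw [aritF, ins, ins, hL, sub_add_eq_add_sub, hR]
  ring

theorem IsAlt.ariF_dif {A B : List V → K} (hA : A [] = 0) (hB : B [] = 0)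
    (hA' : ∀ p, IsAlt fun w => A (dif p w)) (hB' : ∀ p, IsAlt fun w => B (dif p w))
    (hAp : IsPushInv A) (hBp : IsPushInv B) (p : V) :
    IsAlt (fun w => WordSum.ariF A B (dif p w)) := by
  have h1 : IsAlt (WordSum.ins (fun z b => B (dif z b)) (fun z _ => z) (fun w => A (dif p w))) :=
    (hA' p).ins hB' fun _ _ _ _ => rfl
  have h2 : IsAlt (WordSum.ins (fun z b => A (dif z b)) (fun z _ => z) (fun w => B (dif p w))) :=
    (hB' p).ins hA' fun _ _ _ _ => rfl
  have h3 := ((hB' p).lu (hA' p)).add (h2.sub h1)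
  convert h3 using 1
  funext w
  have e1 := aritF_dif (A := A) hB hBp p w
  have e2 := aritF_dif (A := B) hA hAp p w
  rw [WordSum.ariF]
  linear_combination e1 - e2

end Swap

/-! #### Push-invariance of bialternal functions -/

section Push

variable [Field K] [CharZero K] {A : List V → K}

/-- Reversing the points reverses and negates the differences of the rotated sequence. The reversal
signs of the two alternality conditions are equal and cancel. -/
theorem IsAlt.dif_rotate (hA : IsAlt A) (hA' : ∀ p, IsAlt fun w => A (dif p w)) (p q : V)
    (w : List V) : A (dif p (q :: w)) = A ((dif q (w ++ [p])).map (-·)) := by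
  have h1 := (hA' p).reverse w q
  rw [dif_reverse] at h1
  obtain ⟨z, y, hzy⟩ : ∃ z y, (dif q (w ++ [p])).map (-·) = z :: y :=
    List.exists_cons_of_ne_nil (by
      intro h
      simpa using congrArg List.length h)
  have hlen : y.length = w.length := by
    simpa using (congrArg List.length hzy).symm
  rw [hzy, hA.reverse, hlen] at h1
  rw [hzy]
  exact (mul_left_cancel₀ (pow_ne_zero _ (neg_ne_zero.2 one_ne_zero)) h1).symm

/-- Twice the odd part g vanishes. Rotating the points changes the sign of g, and in length at least
2 the shuffles of [x] with ql based at p and of [x] with lp based at q can be compared: all terms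
cancel but one, which occurs twice. -/
theorem IsAlt.map_neg (hA : IsAlt A) (hA' : ∀ p, IsAlt fun w => A (dif p w))
    (heven : ∀ z, A [-z] = A [z]) (w : List V) : A (w.map (-·)) = A w := by
  have hN' : ∀ p, IsAlt fun w => A ((dif p w).map (-·)) := by
    intro p
    simp only [← dif_map_neg]
    exact (hA' (-p)).comp_map (-·)
  set g : List V → K := fun w => A w - A (w.map (-·)) with hg
  have hg' : ∀ p, IsAlt fun w => g (dif p w) := fun p => (hA' p).sub (hN' p)
  have hrot : ∀ (p q : V) (w : List V), g (dif q (w ++ [p])) = - g (dif p (q :: w)) := by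
    intro p q w
    have h1 := hA.dif_rotate hA' p q w
    have h2 := hA.dif_rotate hA' (-p) (-q) (w.map (-·))
    have e1 : dif (-p) (-q :: w.map (-·)) = (dif p (q :: w)).map (-·) := dif_map_neg p (q :: w)
    have e2 : dif (-q) (w.map (-·) ++ [-p]) = (dif q (w ++ [p])).map (-·) := by
      simpa using dif_map_neg q (w ++ [p])
    rw [e1, e2] at h2
    simp only [List.map_map, Function.comp_def, neg_neg, List.map_id'] at h2
    simp only [hg, h1, h2]
    ring
  suffices h : g w = 0 from (sub_eq_zero.1 h).symm
  rcases w with _ | ⟨z, _ | ⟨z', w⟩⟩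
  · simp [hg]
  · simp [hg, heven]
  · obtain ⟨v, hv⟩ := exists_dif_eq 0 (z :: z' :: w)
    rcases v with _ | ⟨x, _ | ⟨q, l⟩⟩
    · simp at hv
    · simp at hv
    rw [← hv]
    generalize (0 : V) = p
    have h1 := (hg' p).sh_eq_zero [x] (q :: l) (by simp) (by simp)
    have h2 := (hg' q).sh_eq_zero [x] (l ++ [p]) (by simp) (by simp)
    rw [← List.nil_append [x], sh_append_cons] at h1 h2
    simp only [sh_nil_left, spl_cons, spl_append_singleton, List.nil_append] at h1 h2
    have e1 : ∀ a b : List V, g (dif q (a ++ x :: (b ++ [p]))) = - g (dif p (q :: a ++ x :: b)) := by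
      intro a b
      rw [← List.cons_append, ← List.append_assoc, hrot, List.cons_append]
    -- Two rotations, so the sign is restored.
    have e2 : g (dif q (l ++ [p] ++ [x])) = g (dif p (x :: q :: l)) := by
      rw [hrot, ← List.cons_append, hrot, neg_neg]
    rw [e2] at h2
    simp only [e1, spl_neg] at h2
    have h3 : (2 : K) * g (dif p (x :: q :: l)) = 0 := by linear_combination h1 + h2
    simpa using h3

theorem IsAlt.isPushInv (hA : IsAlt A) (hA' : ∀ p, IsAlt fun w => A (dif p w))
    (heven : ∀ z, A [-z] = A [z]) : IsPushInv A := by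
  intro p w y
  rw [hA.dif_rotate hA', hA.map_neg hA' heven]

end Push

end Points
end WordSum

/-! ### Evaluation of rational functions at generic words -/

section Evaluation

variable {K L : Type*} [Field K] [Algebra ℚ K] [Field L] [Algebra ℚ L]

theorem RatFun.map_eval {m : ℕ} (φ : K →ₐ[ℚ] L) (f : RatFun m) (x : Fin m → K) :
    φ (RatFun.eval f x) = RatFun.eval f (fun i => φ (x i)) := by
  simp only [RatFun.eval, map_div₀, MvPolynomial.comp_aeval_apply]

/-- Evaluation at an algebraically independent tuple as a homomorphism of fields. -/
noncomputable def RatFun.evalHom {m : ℕ} {x : Fin m → K} (hx : AlgebraicIndependent ℚ x) :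
    RatFun m →ₐ[ℚ] K :=
  IsFractionRing.liftAlgHom (g := MvPolynomial.aeval x)
    (algebraicIndependent_iff_injective_aeval.1 hx)

theorem RatFun.evalHom_algebraMap {m : ℕ} {x : Fin m → K} (hx : AlgebraicIndependent ℚ x)
    (p : MvPolynomial (Fin m) ℚ) :
    RatFun.evalHom hx (algebraMap _ _ p) = MvPolynomial.aeval x p := by
  simp [evalHom]

theorem RatFun.evalHom_apply {m : ℕ} {x : Fin m → K} (hx : AlgebraicIndependent ℚ x)
    (f : RatFun m) : RatFun.evalHom hx f = RatFun.eval f x := by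
  have h := IsFractionRing.mk'_num_den' (MvPolynomial (Fin m) ℚ) f
  conv_lhs => rw [← h]
  rw [map_div₀, evalHom_algebraMap, evalHom_algebraMap]
  rfl

theorem RatFun.evalHom_var {m : ℕ} {x : Fin m → K} (hx : AlgebraicIndependent ℚ x)
    (i : Fin m) : RatFun.evalHom hx (Mould.var i) = x i := by
  rw [Mould.var, evalHom_algebraMap, MvPolynomial.aeval_X]

namespace Mould

theorem eval_eq_evalWord (A : Mould) {n : ℕ} (w : List K) (h : w.length = n) :
    RatFun.eval (A n) (fun i => w.get (i.cast h.symm)) = A.evalWord w := by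
  subst h; rfl

theorem evalWord_ofFn (A : Mould) {n : ℕ} (x : Fin n → K) :
    A.evalWord (List.ofFn x) = RatFun.eval (A n) x := by
  rw [← eval_eq_evalWord A (List.ofFn x) List.length_ofFn]
  simp

theorem map_evalWord (φ : K →ₐ[ℚ] L) (A : Mould) (w : List K) :
    φ (A.evalWord w) = A.evalWord (w.map φ) := by
  rw [evalWord, RatFun.map_eval, ← eval_eq_evalWord A (w.map φ) (List.length_map φ)]
  simp

theorem evalWord_nil {A : Mould} (hA : A ∈ ARI) : A.evalWord ([] : List K) = 0 := by
  have h : A 0 = algebraMap (MvPolynomial (Fin 0) ℚ) (RatFun 0) 0 /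
      algebraMap (MvPolynomial (Fin 0) ℚ) (RatFun 0) 1 := by
    rw [map_zero, zero_div]; exact hA
  change RatFun.eval (A 0) _ = 0
  rw [h, RatFun.eval_div _ _ _ (by simp)]
  simp

end Mould

end Evaluation

/-! ### Generic words of linear forms -/

namespace Mould

section Generic

variable {K : Type*} [Field K] [Algebra ℚ K] {r : ℕ} {e : Fin r → K}

/-- A word is generic with respect to `e` if its letters are linearly independent linear
combinations of the `e i`. -/
def Gen (e : Fin r → K) (w : List K) : Prop :=
  (∀ z ∈ w, z ∈ Submodule.span ℚ (Set.range e)) ∧ LinearIndependent ℚ w.get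

/-- A linear left inverse of the matrix of the forms induces a homomorphism θ of polynomial rings
that undoes the substitution, which is therefore injective. -/
theorem algebraicIndependent_of_linearForms (he : AlgebraicIndependent ℚ e) {m : ℕ}
    {x : Fin m → K} (hx : ∀ i, x i ∈ Submodule.span ℚ (Set.range e))
    (hli : LinearIndependent ℚ x) : AlgebraicIndependent ℚ x := by
  choose M hM using fun i => (Submodule.mem_span_range_iff_exists_fun ℚ).1 (hx i)
  obtain ⟨g, hg⟩ := LinearMap.exists_leftInverse_of_injective (Fintype.linearCombination ℚ x)
    (LinearMap.ker_eq_bot.2 (linearIndependent_iff_injective_fintypeLinearCombination.1 hli))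
  have hgx : ∀ i, g (x i) = Pi.single i 1 := by
    intro i
    have := LinearMap.congr_fun hg (Pi.single i 1)
    simpa [Fintype.linearCombination_apply_single] using this
  let lin : Fin m → MvPolynomial (Fin r) ℚ := fun i => ∑ j, M i j • MvPolynomial.X j
  let back : (Fin m → ℚ) →ₗ[ℚ] MvPolynomial (Fin m) ℚ :=
    Fintype.linearCombination ℚ MvPolynomial.X
  let θ : MvPolynomial (Fin r) ℚ →ₐ[ℚ] MvPolynomial (Fin m) ℚ :=
    MvPolynomial.aeval fun j => back (g (e j))
  have hθ : ∀ i, θ (lin i) = MvPolynomial.X i := by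
    intro i
    calc θ (lin i) = ∑ j, M i j • back (g (e j)) := by simp [θ, lin]
      _ = back (g (x i)) := by simp only [← hM i, map_sum, map_smul]
      _ = _ := by rw [hgx]; simp [back, Fintype.linearCombination_apply_single]
  have hinv : Function.LeftInverse θ (MvPolynomial.aeval lin) := by
    intro p
    rw [MvPolynomial.comp_aeval_apply]
    simp [hθ]
  have hxl : x = fun i => MvPolynomial.aeval e (lin i) := by
    funext i
    simp [lin, ← hM i]
  rw [algebraicIndependent_iff_injective_aeval] at he ⊢
  intro p q hpq
  apply hinv.injective
  apply he
  rwa [MvPolynomial.comp_aeval_apply, MvPolynomial.comp_aeval_apply, ← hxl]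

theorem Gen.algebraicIndependent (he : AlgebraicIndependent ℚ e) {w : List K} (h : Gen e w) :
    AlgebraicIndependent ℚ w.get :=
  algebraicIndependent_of_linearForms he (fun i => h.1 _ (List.get_mem w i)) h.2

theorem linearIndependent_get_iff {w : List K} :
    LinearIndependent ℚ w.get ↔
      w.length = Module.finrank ℚ (Submodule.span ℚ {z | z ∈ w}) := by
  rw [linearIndependent_iff_card_eq_finrank_span, Fintype.card_fin, Set.range_list_get]
  rfl

/-- Independence of a word is equality of its length with the dimension of its span, so it depends
on these two data only. -/
theorem Gen.of_span {w w' : List K} (h : Gen e w) (hlen : w'.length = w.length)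
    (h1 : ∀ z ∈ w', z ∈ Submodule.span ℚ {z | z ∈ w})
    (h2 : ∀ z ∈ w, z ∈ Submodule.span ℚ {z | z ∈ w'}) : Gen e w' := by
  refine ⟨fun z hz => Submodule.span_le.2 h.1 (h1 z hz), ?_⟩
  have e : Submodule.span ℚ {z | z ∈ w'} = Submodule.span ℚ {z | z ∈ w} :=
    le_antisymm (Submodule.span_le.2 h1) (Submodule.span_le.2 h2)
  rw [linearIndependent_get_iff, e, hlen]
  exact linearIndependent_get_iff.1 h.2

theorem Gen.perm {w w' : List K} (h : Gen e w) (hp : w'.Perm w) : Gen e w' :=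
  h.of_span hp.length_eq (fun _ hz => Submodule.subset_span (hp.mem_iff.1 hz))
    (fun _ hz => Submodule.subset_span (hp.mem_iff.2 hz))

theorem Gen.sublist {w w' : List K} (h : Gen e w) (hs : w'.Sublist w) : Gen e w' := by
  refine ⟨fun z hz => h.1 z (hs.subset hz), ?_⟩
  obtain ⟨f, hf⟩ := List.sublist_iff_exists_fin_orderEmbedding_get_eq.1 hs
  have : w'.get = w.get ∘ f := funext hf
  rw [this]
  exact h.2.comp _ f.injective

theorem Gen.flex {a b c : List K} {z : K} (h : Gen e (a ++ (b ++ z :: c))) :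
    Gen e (a ++ (z + b.sum) :: c) := by
  -- Appending the removed letters restores the length and the span of the original word.
  suffices h' : Gen e ((a ++ (z + b.sum) :: c) ++ b) from h'.sublist (List.sublist_append_left _ _)
  have hb : ∀ S : Submodule ℚ K, (∀ y ∈ b, y ∈ S) → b.sum ∈ S :=
    fun S hS => list_sum_mem hS
  refine h.of_span (by simp; omega) ?_ ?_
  · intro y hy
    by_cases hyz : y = z + b.sum
    · rw [hyz]
      refine add_mem (Submodule.subset_span (by simp)) (hb _ fun y hy => ?_)
      exact Submodule.subset_span (by simp [hy])
    · refine Submodule.subset_span ?_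
      simp only [List.mem_append, List.mem_cons, hyz, false_or] at hy
      simp only [Set.mem_ofPred_eq, List.mem_append, List.mem_cons]
      tauto
  · intro y hy
    by_cases hyz : y = z
    · rw [hyz, ← add_sub_cancel_right z b.sum]
      refine sub_mem (Submodule.subset_span (by simp)) (hb _ fun y hy => ?_)
      exact Submodule.subset_span (by simp [hy])
    · refine Submodule.subset_span ?_
      simp only [List.mem_append, List.mem_cons, hyz, false_or] at hy
      simp only [Set.mem_ofPred_eq, List.mem_append, List.mem_cons]
      tauto

theorem Gen.flex' {a b c : List K} {z : K} (h : Gen e (a ++ z :: (b ++ c))) :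
    Gen e (a ++ (z + b.sum) :: c) :=
  (h.perm (List.perm_middle.append_left a)).flex

theorem gen_ofFn (he : AlgebraicIndependent ℚ e) : Gen e (List.ofFn e) := by
  refine ⟨fun z hz => Submodule.subset_span ?_, ?_⟩
  · simpa [List.mem_ofFn] using hz
  · have h : (List.ofFn e).get = e ∘ Fin.cast (by simp) := by
      funext i; simp; rfl
    rw [h]
    exact he.linearIndependent.comp _ (Fin.cast_injective _)

theorem algebraicIndependent_var : AlgebraicIndependent ℚ (var (r := r)) :=
  (MvPolynomial.algebraicIndependent_X (Fin r) ℚ).map'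
    (f := Algebra.algHom ℚ (MvPolynomial (Fin r) ℚ) (RatFun r))
    (IsFractionRing.injective (MvPolynomial (Fin r) ℚ) (RatFun r))

theorem gen_vars : Gen var (vars r) := gen_ofFn algebraicIndependent_var

open WordSum

theorem mem_span_of_mem_dif {p : K} {w : List K} {S : Submodule ℚ K}
    (hp : p ∈ S) : (∀ z ∈ dif p w, z ∈ S) ↔ ∀ z ∈ w, z ∈ S := by
  induction w generalizing p with
  | nil => simp
  | cons q w ih =>
    have h : q - p ∈ S ↔ q ∈ S := ⟨fun h => by simpa using add_mem h hp, fun h => sub_mem h hp⟩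
    rw [dif_cons, List.forall_mem_cons, List.forall_mem_cons, h]
    exact and_congr_right fun hq => ih hq

theorem gen_dif_iff {w : List K} : Gen e (dif 0 w) ↔ Gen e w := by
  have h1 := (mem_span_of_mem_dif (w := w)
    (zero_mem (Submodule.span ℚ {z | z ∈ w}))).2 fun z hz => Submodule.subset_span hz
  have h2 := (mem_span_of_mem_dif (w := w)
    (zero_mem (Submodule.span ℚ {z | z ∈ dif 0 w}))).1 fun z hz => Submodule.subset_span hz
  exact ⟨fun h => h.of_span (length_dif 0 w).symm h2 h1,
    fun h => h.of_span (length_dif 0 w) h1 h2⟩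

end Generic

end Mould

/-! ### Comparison with sums over permutations and over indices -/

namespace WordSum

section Permutations

variable {V K : Type*} [AddCommMonoid K]

/-- When the two words use disjoint alphabets, a word arises from at most one shuffle, and its
restrictions to the alphabets recover x and y. -/
theorem sh_ite [DecidableEq V] (P : V → Prop) [DecidablePred P] (k : K) (w x y : List V)
    (hx : ∀ z ∈ x, P z) (hy : ∀ z ∈ y, ¬ P z) :
    sh (fun v => if v = w then k else 0) x y =
      if w.filter (P ·) = x ∧ w.filter (¬ P ·) = y then k else 0 := by
  induction x, y using sh_induction generalizing w with
  | h1 y =>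
    rw [sh_nil_left]
    refine if_congr ⟨?_, ?_⟩ rfl rfl
    · rintro rfl
      exact ⟨by simpa using hy, by simpa using hy⟩
    · rintro ⟨h1, h2⟩
      rw [← h2, List.filter_eq_self]
      simpa using h1
  | h2 x =>
    rw [sh_nil_right]
    refine if_congr ⟨?_, ?_⟩ rfl rfl
    · rintro rfl
      exact ⟨by simpa using hx, by simpa using hx⟩
    · rintro ⟨h1, h2⟩
      rw [← h1, List.filter_eq_self]
      simpa using h2
  | h3 a x b y ih1 ih2 =>
    rw [sh_cons_cons]
    have ha := hx a (by simp)
    have hb := hy b (by simp)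
    cases w with
    | nil => simp
    | cons c w =>
      by_cases hc : P c
      · have hbc : b ≠ c := fun h => hb (h ▸ hc)
        by_cases hac : a = c
        · subst hac
          simpa [hbc, hc] using ih1 w (fun z hz => hx z (by simp [hz])) hy
        · simp [hbc, hac, hc, Ne.symm hac]
      · have hac : a ≠ c := fun h => hc (h ▸ ha)
        by_cases hbc : b = c
        · subst hbc
          simpa [hac, hc] using ih2 w hx (fun z hz => hy z (by simp [hz]))
        · simp [hbc, hac, hc, Ne.symm hbc]

theorem filter_ofFn_perm_iff {r : ℕ} (P : Fin r → Prop) [DecidablePred P]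
    (σ : Equiv.Perm (Fin r)) :
    (List.ofFn σ.symm).filter (P ·) = (List.finRange r).filter (P ·) ↔
      ∀ i j, i < j → P i → P j → σ i < σ j := by
  have hsort : ((List.finRange r).filter (P ·)).Pairwise (· < ·) :=
    (List.pairwise_lt_finRange r).sublist List.filter_sublist
  constructor
  · intro h i j hij hi hj
    rw [← h, List.pairwise_filter, List.pairwise_ofFn] at hsort
    by_contra hlt
    have hne : σ j ≠ σ i := fun h => hij.ne' (σ.injective h)
    have := hsort (lt_of_le_of_ne (not_lt.1 hlt) hne) (by simpa using hj) (by simpa using hi)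
    simp only [Equiv.symm_apply_apply] at this
    exact absurd hij this.asymm
  · intro h
    refine List.Perm.eq_of_pairwise (le := (· < ·)) ?_ ?_ hsort ?_
    · intro a b _ _ h1 h2
      exact absurd h1 h2.asymm
    · rw [List.pairwise_filter, List.pairwise_ofFn]
      intro a b hab ha hb
      by_contra hlt
      have hne : σ.symm b ≠ σ.symm a := fun h => hab.ne' (σ.symm.injective h)
      have := h _ _ (lt_of_le_of_ne (not_lt.1 hlt) hne) (by simpa using hb) (by simpa using ha)
      simp only [Equiv.apply_symm_apply] at this
      exact absurd hab this.asymm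
    · refine List.Perm.filter _ ?_
      rw [← List.map_id (List.finRange r), List.ofFn_eq_map]
      simpa using Equiv.Perm.map_finRange_perm σ.symm

theorem filter_finRange_take (r s : ℕ) :
    (List.finRange r).filter (fun i => decide (i.val < s)) = (List.finRange r).take s := by
  conv_lhs => rw [← List.take_append_drop s (List.finRange r)]
  rw [List.filter_append, List.filter_eq_self.2, List.filter_eq_nil_iff.2, List.append_nil]
  · intro a ha
    obtain ⟨i, hi, rfl⟩ := List.mem_iff_getElem.1 ha
    simp
  · intro a ha
    obtain ⟨i, hi, rfl⟩ := List.mem_iff_getElem.1 ha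
    simp at hi ⊢
    omega

theorem filter_finRange_drop (r s : ℕ) :
    (List.finRange r).filter (fun i => decide (¬ i.val < s)) = (List.finRange r).drop s := by
  conv_lhs => rw [← List.take_append_drop s (List.finRange r)]
  rw [List.filter_append, List.filter_eq_nil_iff.2, List.filter_eq_self.2, List.nil_append]
  · intro a ha
    obtain ⟨i, hi, rfl⟩ := List.mem_iff_getElem.1 ha
    simp
  · intro a ha
    obtain ⟨i, hi, rfl⟩ := List.mem_iff_getElem.1 ha
    simp at hi ⊢
    omega

theorem exists_perm_of_perm_finRange {r : ℕ} {v : List (Fin r)} (hv : v.Perm (List.finRange r)) :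
    ∃ σ : Equiv.Perm (Fin r), v = List.ofFn σ.symm := by
  have hlen : v.length = r := by simpa using hv.length_eq
  have hnd : v.Nodup := hv.nodup_iff.2 (List.nodup_finRange r)
  let f : Fin r → Fin r := fun i => v.get (i.cast hlen.symm)
  have hf : Function.Injective f := fun i j h => by
    simpa using (List.nodup_iff_injective_get.1 hnd) h
  refine ⟨(Equiv.ofBijective f (Finite.injective_iff_bijective.1 hf)).symm, ?_⟩
  refine List.ext_getElem (by simp [hlen]) fun i h1 h2 => ?_
  simp [f]

/-- Shuffle the positions instead of the letters: these are distinct, so F is a sum of indicators of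
permutations, and `sh_ite` turns the shuffle condition into monotonicity on the two blocks. -/
theorem sh_eq_sum_perm {r : ℕ} (s : ℕ) (x : Fin r → V) (F : List V → K) :
    sh F ((List.ofFn x).take s) ((List.ofFn x).drop s) =
      ∑ σ : Equiv.Perm (Fin r) with
        (∀ i j : Fin r, i < j → j.val < s → σ i < σ j) ∧
        (∀ i j : Fin r, i < j → s ≤ i.val → σ i < σ j),
      F (List.ofFn fun i => x (σ.symm i)) := by
  rw [List.ofFn_eq_map, ← List.map_take, ← List.map_drop, sh_map]
  have h1 : sh (fun w : List (Fin r) => F (w.map x)) ((List.finRange r).take s)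
      ((List.finRange r).drop s) = sh (fun v => ∑ σ : Equiv.Perm (Fin r),
        if v = List.ofFn σ.symm then F (List.ofFn fun i => x (σ.symm i)) else 0)
        ((List.finRange r).take s) ((List.finRange r).drop s) := by
    refine sh_congr fun v hv => ?_
    rw [List.take_append_drop] at hv
    obtain ⟨σ, rfl⟩ := exists_perm_of_perm_finRange hv
    rw [Finset.sum_eq_single σ]
    · rw [if_pos rfl, List.map_ofFn]; rfl
    · intro τ _ hτ
      refine if_neg fun h => hτ ?_
      have := List.ofFn_injective h
      rw [← Equiv.symm_symm σ, ← Equiv.symm_symm τ]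
      congr 1
      exact (Equiv.coe_fn_injective this).symm
    · simp
  have h2 := map_sum (shHom (K := K) ((List.finRange r).take s) ((List.finRange r).drop s))
    (fun (σ : Equiv.Perm (Fin r)) v =>
      if v = List.ofFn σ.symm then F (List.ofFn fun i => x (σ.symm i)) else 0) Finset.univ
  rw [h1, Finset.sum_filter]
  refine Eq.trans (congrArg (fun G => sh G _ _) ?_) (h2.trans (Finset.sum_congr rfl ?_))
  · funext v
    rw [Finset.sum_apply]
  · intro σ _
    refine (sh_ite (fun i : Fin r => i.val < s) _ _ _ _ ?_ ?_).trans (if_congr ?_ rfl rfl)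
    · intro z hz
      rw [← filter_finRange_take] at hz
      simpa using (List.mem_filter.1 hz).2
    · intro z hz
      rw [← filter_finRange_drop] at hz
      simpa using (List.mem_filter.1 hz).2
    · rw [← filter_finRange_take, ← filter_finRange_drop]
      refine and_congr ((filter_ofFn_perm_iff (fun i : Fin r => i.val < s) σ).trans ?_)
        ((filter_ofFn_perm_iff (fun i : Fin r => ¬ i.val < s) σ).trans ?_)
      · exact ⟨fun h i j hij hj => h i j hij
          ((show i.val < j.val from hij).trans hj) hj, fun h i j hij _ hj => h i j hij hj⟩
      · exact ⟨fun h i j hij hi => h i j hij (not_lt.2 hi) (not_lt.2 (hi.trans hij.le)),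
          fun h i j hij hi _ => h i j hij (not_lt.1 hi)⟩

end Permutations

section Transfer

variable {V K : Type*}

theorem spl_spl_eq_sum [AddCommMonoid K] (F : List V → List V → List V → K) (w : List V) :
    spl (fun a t => spl (fun b c => F a b c) t) w =
      ∑ k ∈ Finset.range (w.length + 1), ∑ l ∈ Finset.Icc k w.length,
        F (w.take k) ((w.take l).drop k) (w.drop l) := by
  rw [spl_eq_sum]
  refine Finset.sum_congr rfl fun k hk => ?_
  have hk' : k ≤ w.length := Nat.lt_succ_iff.1 (Finset.mem_range.1 hk)
  rw [spl_eq_sum, List.length_drop, ← Finset.Ico_succ_right_eq_Icc, Finset.sum_Ico_eq_sum_range]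
  refine Finset.sum_congr (by congr 1; simp; omega) fun i _ => ?_
  rw [List.drop_drop, List.drop_take, Nat.add_sub_cancel_left]

variable [Field V] [CommRing K]

theorem aritF_eq_sum {A B : List V → K} (hB : B [] = 0) (w : List V) :
    aritF B A w =
      (∑ k ∈ Finset.range w.length, ∑ l ∈ Finset.Ioo k w.length,
        A (Mould.flexR (w.take k) ((w.take l).drop k) (w.drop l)) * B ((w.take l).drop k)) -
      ∑ k ∈ Finset.Icc 1 w.length, ∑ l ∈ Finset.Ioc k w.length,
        A (Mould.flexL (w.take k) ((w.take l).drop k) (w.drop l)) * B ((w.take l).drop k) := by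
  rw [aritF, ins]
  congr 1
  -- The sum is extended by zero to empty c; terms with empty b vanish since B [] = 0. This closes
  -- the gap between l in `Icc k r` and l in `Ioo k r`.
  · let FR : List V → List V → List V → K := fun a b c =>
      if c = [] then 0 else A (Mould.flexR a b c) * B b
    have h1 : splL (fun s z c => spl (fun a b => A (a ++ (z + b.sum) :: c) * B b) s) w =
        spl (fun a t => spl (fun b c => FR a b c) t) w := by
      rw [← spl_assoc, spl_eq_nil_right]
      simp [FR, Mould.flexR, add_comm]
    rw [h1, spl_spl_eq_sum, Finset.sum_range_succ]
    have h2 : ∑ l ∈ Finset.Icc w.length w.length,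
        FR (w.take w.length) ((w.take l).drop w.length) (w.drop l) = 0 := by
      simp [FR]
    rw [h2, add_zero]
    refine Finset.sum_congr rfl fun k _ => ?_
    symm
    refine (Finset.sum_congr rfl fun l hl => ?_).trans
      (Finset.sum_subset Finset.Ioo_subset_Icc_self fun l hl hl' => ?_)
    · have : w.drop l ≠ [] := by
        rw [Ne, List.drop_eq_nil_iff]; have := (Finset.mem_Ioo.1 hl).2; omega
      simp [FR, this]
    · rw [Finset.mem_Icc] at hl
      rw [Finset.mem_Ioo] at hl'
      rcases eq_or_lt_of_le hl.1 with rfl | h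
      · simp [FR, hB]
      · have : w.drop l = [] := by rw [List.drop_eq_nil_iff]; omega
        simp [FR, this]
  · let FL : List V → List V → List V → K := fun a b c =>
      if a = [] then 0 else A (Mould.flexL a b c) * B b
    have h1 : splL (fun a z s => spl (fun b c => A (a ++ (z + b.sum) :: c) * B b) s) w =
        spl (fun a t => spl (fun b c => FL a b c) t) w := by
      rw [spl_eq_nil_left]
      simp [FL, Mould.flexL, List.getLastD_eq_getLast?]
    rw [h1, spl_spl_eq_sum, Finset.range_eq_Ico, Finset.sum_eq_sum_Ico_succ_bot (by omega)]
    have h2 : ∑ l ∈ Finset.Icc 0 w.length,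
        FL (w.take 0) ((w.take l).drop 0) (w.drop l) = 0 := by
      simp [FL]
    rw [h2, zero_add, zero_add,
      show Finset.Ico 1 (w.length + 1) = Finset.Icc 1 w.length by ext; simp]
    refine Finset.sum_congr rfl fun k hk => ?_
    rw [Finset.mem_Icc] at hk
    have hk0 : w.take k ≠ [] := by
      intro h
      have := congrArg List.length h
      simp at this
      rcases this with h | h
      · omega
      · simp [h] at hk; omega
    symm
    refine (Finset.sum_congr rfl fun l hl => ?_).trans
      (Finset.sum_subset Finset.Ioc_subset_Icc_self fun l hl hl' => ?_)
    · simp only [FL, if_neg hk0]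
    · rw [Finset.mem_Icc] at hl
      rw [Finset.mem_Ioc] at hl'
      have : k = l := by omega
      simp [FL, ← this, hB]

end Transfer

end WordSum

namespace WordSum

theorem getElem_dif {V : Type*} [AddCommGroup V] (p : V) (w : List V) (i : ℕ)
    (h : i < (dif p w).length) :
    (dif p w)[i] = w[i]'(by simpa using h) - (p :: w)[i]'(by simp at h ⊢; omega) := by
  induction w generalizing p i with
  | nil => simp at h
  | cons q w ih =>
    cases i with
    | zero => simp
    | succ i => simpa using ih q i (by simpa using h)

end WordSum

/-! ### Moulds as functions on generic words -/

namespace Mould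

open WordSum

section

variable {K L : Type*} [Field K] [Field L]

theorem map_flexR (φ : K →+* L) (a b c : List K) :
    (flexR a b c).map φ = flexR (a.map φ) (b.map φ) (c.map φ) := by
  cases c <;> simp [flexR, map_list_sum]

theorem map_flexL (φ : K →+* L) (a b c : List K) :
    (flexL a b c).map φ = flexL (a.map φ) (b.map φ) (c.map φ) := by
  rcases List.eq_nil_or_concat a with rfl | ⟨a, z, rfl⟩
  · simp [flexL, map_list_sum]
  · simp [flexL, map_list_sum, List.getLastD_eq_getLast?]

end

theorem _root_.RatFun.smul_eq {n : ℕ} (k : ℚ) (f : RatFun n) : k • f = (k : RatFun n) * f := by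
  simpa using ratCast_smul_eq ℚ (RatFun n) k f

section Generic

variable {K : Type*} [Field K] [Algebra ℚ K] {r : ℕ} {e : Fin r → K}
  (he : AlgebraicIndependent ℚ e) {w : List K} (hw : Gen e w)
include he hw

theorem evalWord_eq_evalHom (A : Mould) :
    A.evalWord w = RatFun.evalHom (hw.algebraicIndependent he) (A w.length) :=
  (RatFun.evalHom_apply _ _).symm

theorem map_vars_evalHom :
    (vars w.length).map (RatFun.evalHom (hw.algebraicIndependent he)) = w := by
  rw [vars, List.map_ofFn]
  conv_rhs => rw [← List.ofFn_get w]
  congr 1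
  funext i
  exact RatFun.evalHom_var _ i

theorem evalWord_add (A B : Mould) : (A + B).evalWord w = A.evalWord w + B.evalWord w := by
  simp only [evalWord_eq_evalHom he hw, Pi.add_apply, map_add]

theorem evalWord_sub (A B : Mould) : (A - B).evalWord w = A.evalWord w - B.evalWord w := by
  simp only [evalWord_eq_evalHom he hw, Pi.sub_apply, map_sub]

theorem evalWord_smul (k : ℚ) (A : Mould) :
    (k • A).evalWord w = algebraMap ℚ K k * A.evalWord w := by
  simp only [evalWord_eq_evalHom he hw, Pi.smul_apply]
  rw [RatFun.smul_eq, map_mul, map_ratCast, eq_ratCast]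

theorem evalWord_mu (A B : Mould) :
    (mu A B).evalWord w = muF A.evalWord B.evalWord w := by
  rw [evalWord_eq_evalHom he hw, mu, map_sum, muF, spl_eq_sum]
  refine Finset.sum_congr rfl fun i _ => ?_
  rw [map_mul, map_evalWord, map_evalWord, List.map_take, List.map_drop,
    map_vars_evalHom he hw]

theorem evalWord_arit {A B : Mould} (hB : B ∈ ARI) :
    (arit B A).evalWord w = aritF B.evalWord A.evalWord w := by
  rw [evalWord_eq_evalHom he hw, aritF_eq_sum (evalWord_nil hB), arit, map_sub, map_sum, map_sum]
  have hR := map_flexR (RatFun.evalHom (hw.algebraicIndependent he)).toRingHom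
  have hL := map_flexL (RatFun.evalHom (hw.algebraicIndependent he)).toRingHom
  simp only [AlgHom.toRingHom_eq_coe, RingHom.coe_coe] at hR hL
  simp only [map_sum, map_mul, map_evalWord, hR, hL, List.map_take, List.map_drop,
    map_vars_evalHom he hw]

theorem evalWord_ari {A B : Mould} (hA : A ∈ ARI) (hB : B ∈ ARI) :
    (ari A B).evalWord w = ariF A.evalWord B.evalWord w := by
  rw [ari, lu, evalWord_add he hw, evalWord_sub he hw, evalWord_sub he hw,
    evalWord_arit he hw hB, evalWord_arit he hw hA, evalWord_mu he hw, evalWord_mu he hw]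
  rfl

theorem evalWord_swap (A : Mould) :
    (swap A).evalWord w = A.evalWord (dif 0 w.reverse) := by
  rw [evalWord_eq_evalHom he hw, swap, ← evalWord_ofFn, map_evalWord, List.map_ofFn]
  congr 1
  refine List.ext_getElem (by simp) fun i h1 h2 => ?_
  have hi : i < w.length := by simpa using h1
  rw [getElem_dif]
  rcases i with _ | i
  · simp [RatFun.evalHom_var, Fin.rev]
  · have e1 : w.length - 1 - i = w.length - (i + 1) := by omega
    have e2 : w.length - 1 - (i + 1) = w.length - (i + 1 + 1) := by omega
    simp [RatFun.evalHom_var, Fin.rev, e1, e2]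

-- On a generic word the bracket evaluates its arguments at subwords and contractions only, all of
-- them generic.
omit he in
theorem ariF_congr {A B A' B' : List K → K} (hA : ∀ w, Gen e w → A w = A' w)
    (hB : ∀ w, Gen e w → B w = B' w) : ariF A B w = ariF A' B' w := by
  have harit : ∀ {A B A' B' : List K → K}, (∀ w, Gen e w → A w = A' w) →
      (∀ w, Gen e w → B w = B' w) → aritF B A w = aritF B' A' w := by
    intro A B A' B' hA hB
    rw [aritF, aritF, ins, ins]
    congr 1
    · refine splL_congr fun s z c h1 => spl_congr fun a b h2 => ?_
      rw [h1, h2, List.append_assoc] at hw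
      rw [hA _ hw.flex, hB b (hw.sublist ?_)]
      exact (List.sublist_append_left _ _).trans (List.sublist_append_right _ _)
    · refine splL_congr fun a z s h1 => spl_congr fun b c h2 => ?_
      rw [h1, h2] at hw
      rw [hA _ hw.flex', hB b (hw.sublist ?_)]
      exact ((List.sublist_append_left _ _).trans (List.sublist_cons_self _ _)).trans
        (List.sublist_append_right _ _)
  have hmu : ∀ {A B A' B' : List K → K}, (∀ w, Gen e w → A w = A' w) →
      (∀ w, Gen e w → B w = B' w) → muF A B w = muF A' B' w := by
    intro A B A' B' hA hB
    refine spl_congr fun a b h => ?_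
    rw [h] at hw
    rw [hA a (hw.sublist (List.sublist_append_left _ _)),
      hB b (hw.sublist (List.sublist_append_right _ _))]
  rw [ariF, ariF, harit hA hB, harit hB hA, hmu hA hB, hmu hB hA]

end Generic

section Guarded

variable {K : Type*} [Field K] [Algebra ℚ K] {r : ℕ} {e : Fin r → K}

open Classical in
/-- The function on words that takes the values of the mould `A` at generic words, and vanishes
at all other words. -/
noncomputable def fn (e : Fin r → K) (A : Mould) (w : List K) : K :=
  if Gen e w then A.evalWord w else 0

theorem fn_of_gen {w : List K} (hw : Gen e w) (A : Mould) : fn e A w = A.evalWord w := if_pos hw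

theorem fn_of_not_gen {w : List K} (hw : ¬ Gen e w) (A : Mould) : fn e A w = 0 := if_neg hw

theorem fn_nil {A : Mould} (hA : A ∈ ARI) : fn e A [] = 0 := by
  rw [fn, evalWord_nil hA, ite_self]

theorem isAlternal_iff {A : Mould} : A.IsAlternal ↔ ∀ r s : ℕ, 1 ≤ s → s < r →
    sh A.evalWord ((vars r).take s) ((vars r).drop s) = 0 := by
  refine forall_congr' fun r => forall_congr' fun s => imp_congr_right fun _ =>
    imp_congr_right fun _ => ?_
  rw [vars, sh_eq_sum_perm]
  simp only [evalWord_ofFn]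

variable (he : AlgebraicIndependent ℚ e)
include he

theorem fn_add (A B : Mould) : fn e (A + B) = fn e A + fn e B := by
  funext w
  by_cases hw : Gen e w
  · simp only [Pi.add_apply, fn_of_gen hw, evalWord_add he hw]
  · simp only [Pi.add_apply, fn_of_not_gen hw, add_zero]

theorem fn_smul (k : ℚ) (A : Mould) : fn e (k • A) = algebraMap ℚ K k • fn e A := by
  funext w
  by_cases hw : Gen e w
  · simp only [Pi.smul_apply, fn_of_gen hw, evalWord_smul he hw, smul_eq_mul]
  · simp only [Pi.smul_apply, fn_of_not_gen hw, smul_zero]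

theorem fn_ari {A B : Mould} (hA : A ∈ ARI) (hB : B ∈ ARI) {w : List K} (hw : Gen e w) :
    fn e (ari A B) w = ariF (fn e A) (fn e B) w := by
  rw [fn_of_gen hw, evalWord_ari he hw hA hB]
  exact ariF_congr hw (fun w hw => (fn_of_gen hw A).symm) (fun w hw => (fn_of_gen hw B).symm)

/-- The terms of a shuffle are permutations of one word, so all are generic or none is. In the
generic case the relation is the image of the one in the variables under `RatFun.evalHom`. -/
theorem isAlt_fn {A : Mould} (hA : A ∈ ARI) (hal : A.IsAlternal) : IsAlt (fn e A) := by
  refine ⟨fn_nil hA, fun x y hx hy => ?_⟩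
  by_cases hw : Gen e (x ++ y)
  · have h0 := isAlternal_iff.1 hal (x ++ y).length x.length
      (List.length_pos_of_ne_nil hx) (by simpa using List.length_pos_of_ne_nil hy)
    have h := congrArg (RatFun.evalHom (hw.algebraicIndependent he)) h0
    rw [map_zero] at h
    have h1 := map_sh (RatFun.evalHom (hw.algebraicIndependent he)).toRingHom.toAddMonoidHom
      A.evalWord ((vars (x ++ y).length).take x.length) ((vars (x ++ y).length).drop x.length)
    have h2 := h1.symm.trans h
    change sh (fun w => RatFun.evalHom (hw.algebraicIndependent he) (A.evalWord w)) _ _ = 0 at h2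
    simp only [map_evalWord] at h2
    rw [← sh_map (RatFun.evalHom (hw.algebraicIndependent he)), List.map_take, List.map_drop,
      map_vars_evalHom he hw, List.take_left, List.drop_left] at h2
    rw [← h2]
    exact sh_congr fun w hp => fn_of_gen (hw.perm hp) A
  · rw [← sh_zero (K := K) x y]
    exact sh_congr fun w hp => fn_of_not_gen (fun h => hw (h.perm hp.symm)) A

/-- Differences are invariant under translation, so the base point p can be moved to 0, where the
function is `swap A` on the reversed word. -/
theorem isAlt_fn_dif {A : Mould} (hA : A ∈ ARI) (hal : (swap A).IsAlternal) (p : K) :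
    IsAlt (fun w => fn e A (dif p w)) := by
  have hs : swap A ∈ ARI := by
    change RatFun.eval (A 0) _ = 0
    rw [← evalWord_ofFn]
    exact evalWord_nil hA
  have h := ((isAlt_fn he hs hal).comp_reverse).comp_map (· - p)
  convert h using 1
  funext w
  rw [← dif_map_sub p p, sub_self]
  generalize w.map (· - p) = v
  by_cases hv : Gen e v
  · rw [fn_of_gen (gen_dif_iff.2 hv), fn_of_gen (hv.perm v.reverse_perm), evalWord_swap he
      (hv.perm v.reverse_perm), List.reverse_reverse]
  · rw [fn_of_not_gen (fun h => hv (gen_dif_iff.1 h)),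
      fn_of_not_gen (fun h => hv (h.perm v.reverse_perm.symm))]

omit he in
theorem Gen.neg_singleton {z : K} (h : Gen e [z]) : Gen e [-z] :=
  h.of_span rfl (fun y hy => by
    rw [List.mem_singleton.1 hy]
    exact neg_mem (Submodule.subset_span (by simp))) (fun y hy => by
    rw [List.mem_singleton.1 hy, ← neg_neg z]
    exact neg_mem (Submodule.subset_span (by simp)))

theorem fn_neg_singleton {A : Mould} (heven : RatFun.eval (A 1) (fun i => -var i) = A 1) (z : K) :
    fn e A [-z] = fn e A [z] := by
  by_cases hz : Gen e [z]
  · rw [fn_of_gen hz, fn_of_gen hz.neg_singleton, evalWord_eq_evalHom he hz]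
    change _ = RatFun.evalHom _ (A 1)
    rw [← heven, RatFun.map_eval, ← evalWord_ofFn]
    simp only [map_neg, RatFun.evalHom_var]
    rfl
  · rw [fn_of_not_gen hz, fn_of_not_gen]
    intro h
    exact hz (neg_neg z ▸ h.neg_singleton)

theorem isPushInv_fn [CharZero K] {A : Mould} (hA : A ∈ ARIalal) : IsPushInv (fn e A) :=
  (isAlt_fn he hA.1 hA.2.1).isPushInv (isAlt_fn_dif he hA.1 hA.2.2.1)
    (fn_neg_singleton he hA.2.2.2)

end Guarded

/-! ### Bialternality of the bracket -/

section Closure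

theorem evalWord_vars (A : Mould) (r : ℕ) : A.evalWord (vars r) = A r := by
  rw [vars, evalWord_ofFn, ← RatFun.evalHom_apply algebraicIndependent_var]
  have h := IsFractionRing.mk'_num_den' (MvPolynomial (Fin r) ℚ) (A r)
  rw [← h, map_div₀, RatFun.evalHom_algebraMap, RatFun.evalHom_algebraMap]
  have e : ∀ p : MvPolynomial (Fin r) ℚ, MvPolynomial.aeval (var (r := r)) p =
      algebraMap _ (RatFun r) p := by
    intro p
    have := MvPolynomial.comp_aeval_apply (f := MvPolynomial.X)
      (Algebra.algHom ℚ (MvPolynomial (Fin r) ℚ) (RatFun r)) p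
    rw [MvPolynomial.aeval_X_left_apply] at this
    exact this.symm
  rw [e, e]

theorem ari_apply {A B : Mould} (hA : A ∈ ARI) (hB : B ∈ ARI) (r : ℕ) :
    ari A B r = ariF (fn var A) (fn var B) (vars r) := by
  rw [← fn_ari algebraicIndependent_var hA hB gen_vars, fn_of_gen gen_vars, evalWord_vars]

theorem ari_mem_ARI {A B : Mould} (hA : A ∈ ARI) (hB : B ∈ ARI) : ari A B ∈ ARI := by
  change ari A B 0 = 0
  rw [ari_apply hA hB]
  exact ariF_nil (fn_nil hA)

theorem ari_mem_ARIalal {A B : Mould} (hA : A ∈ ARIalal) (hB : B ∈ ARIalal) :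
    ari A B ∈ ARIalal := by
  have hu := fun r => algebraicIndependent_var (r := r)
  refine ⟨ari_mem_ARI hA.1 hB.1, isAlternal_iff.2 fun r s h1 h2 => ?_,
    isAlternal_iff.2 fun r s h1 h2 => ?_, ?_⟩
  · have h := ((isAlt_fn (hu r) hA.1 hA.2.1).ariF (isAlt_fn (hu r) hB.1 hB.2.1)).sh_eq_zero
      ((vars r).take s) ((vars r).drop s)
      (List.ne_nil_of_length_pos (by simp [vars]; omega))
      (List.ne_nil_of_length_pos (by simp [vars]; omega))
    rw [← h]
    refine sh_congr fun w hw => ?_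
    have hg : Gen var w := gen_vars.perm (by rwa [List.take_append_drop] at hw)
    rw [← fn_ari (hu r) hA.1 hB.1 hg, fn_of_gen hg]
  · have h := (IsAlt.ariF_dif (fn_nil hA.1) (fn_nil hB.1) (isAlt_fn_dif (hu r) hA.1 hA.2.2.1)
      (isAlt_fn_dif (hu r) hB.1 hB.2.2.1) (isPushInv_fn (hu r) hA)
      (isPushInv_fn (hu r) hB) 0).comp_reverse.sh_eq_zero
      ((vars r).take s) ((vars r).drop s)
      (List.ne_nil_of_length_pos (by simp [vars]; omega))
      (List.ne_nil_of_length_pos (by simp [vars]; omega))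
    rw [← h]
    refine sh_congr fun w hw => ?_
    have hg : Gen var w := gen_vars.perm (by rwa [List.take_append_drop] at hw)
    have hg' : Gen var (dif 0 w.reverse) := gen_dif_iff.2 (hg.perm w.reverse_perm)
    rw [← fn_ari (hu r) hA.1 hB.1 hg', fn_of_gen hg', evalWord_swap (hu r) hg]
  -- In depth 1 every term contains a value at the empty word.
  · have h : ari A B 1 = 0 := by
      rw [ari_apply hA.1 hB.1]
      simp [vars, ariF, aritF, ins, splL_cons, spl_cons, muF, fn_nil hA.1, fn_nil hB.1]
    rw [h]
    have h0 := RatFun.eval_div (0 : MvPolynomial (Fin 1) ℚ) 1 (fun i => -var (r := 1) i) (by simp)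
    simpa using h0

end Closure

end Mould

/-! ### Poles of the ari-bracket -/

namespace WordSum

section Map

variable {V W K : Type*}

theorem spl_map [AddCommMonoid K] (g : V → W) (F : List W → List W → K) (w : List V) :
    spl F (w.map g) = spl (fun a b => F (a.map g) (b.map g)) w := by
  induction w generalizing F with
  | nil => rfl
  | cons z w ih => rw [List.map_cons, spl_cons, ih]; rfl

theorem splL_map [AddCommMonoid K] (g : V → W) (F : List W → W → List W → K) (w : List V) :
    splL F (w.map g) = splL (fun a z b => F (a.map g) (g z) (b.map g)) w := by
  induction w generalizing F with
  | nil => rfl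
  | cons z w ih => rw [List.map_cons, splL_cons, ih]; rfl

theorem ariF_map [AddCommGroup V] [AddCommGroup W] [CommRing K] (g : V →+ W)
    (A B : List W → K) (w : List V) :
    ariF A B (w.map g) = ariF (fun w => A (w.map g)) (fun w => B (w.map g)) w := by
  simp only [ariF, aritF, ins, muF, splL_map, spl_map, List.map_append, List.map_cons, map_add,
    map_list_sum]

theorem spl_mem [AddCommGroup K] (S : AddSubgroup K) {F : List V → List V → K} {w : List V}
    (h : ∀ a b, w = a ++ b → F a b ∈ S) : spl F w ∈ S := by
  rw [spl_eq_sum]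
  exact sum_mem fun i _ => h _ _ (List.take_append_drop i w).symm

theorem IsPushInv.apply_append_singleton [AddCommGroup V] {A : List V → K} (h : IsPushInv A)
    (m : List V) (y : V) : A (m ++ [y]) = A (-(m.sum + y) :: m) := by
  obtain ⟨v, hv⟩ := exists_dif_eq 0 m
  have hs : m.sum = lst 0 v := by rw [← hv, sum_dif, sub_zero]
  have h1 := h 0 v (lst 0 v + y)
  rw [dif_append, dif_cons, hv] at h1
  simpa [hs, hv] using h1

end Map

section Poles

variable {R K : Type*} [CommRing R] [Field K]

/-- The contribution of the poles along the sums of removed factors. -/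
def poleFactor (ι : R →+* K) (p q : List R → K) (w : List R) : K :=
  spl (fun a t => spl (fun b c => q b * (ι b.sum)⁻¹ *
    ((if c = [] then p a else p (a ++ (c.headD 0 + b.sum) :: c.tail)) -
      if a = [] then p c else p (a.dropLast ++ (a.getLastD 0 + b.sum) :: c))) t) w

/-- The contribution of the poles along the letters created by contractions. -/
def poleLetter (ι : R →+* K) (p q : List R → K) (w : List R) : K :=
  spl (fun a t => spl (fun f c => p (a ++ f.sum :: c) * (ι f.sum)⁻¹ *
    (q f.dropLast - q f.tail)) t) w

variable {ι : R →+* K}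

/-- The cases of empty c and empty a are split off: they match terms of mu(A, B) and mu(B, A), and
the rest matches arit. -/
theorem poleFactor_eq (p q : List R → K) (w : List R) :
    poleFactor ι p q w =
      spl (fun a b => q b * (ι b.sum)⁻¹ * p a) w +
        splL (fun s z c => spl (fun a b => p (a ++ (z + b.sum) :: c) * q b * (ι b.sum)⁻¹) s) w -
      (spl (fun b c => q b * (ι b.sum)⁻¹ * p c) w +
        splL (fun a z s => spl (fun b c => p (a ++ (z + b.sum) :: c) * q b * (ι b.sum)⁻¹) s) w) := by
  rw [poleFactor]
  simp only [mul_sub, spl_sub]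
  congr 1
  · rw [← spl_assoc, spl_eq_nil_right]
    simp only [if_true, reduceCtorEq, if_false, List.headD_cons, List.tail_cons]
    congr 1
    refine splL_congr fun _ _ _ _ => spl_congr fun _ _ _ => ?_
    ring
  · rw [spl_eq_nil_left]
    simp only [if_true, List.append_eq_nil_iff, List.cons_ne_nil, and_false, if_false,
      List.dropLast_concat, List.getLastD_eq_getLast?, List.getLast?_append, List.getLast?_singleton,
      Option.some_or, Option.getD_some]
    congr 1
    refine splL_congr fun _ _ _ _ => spl_congr fun _ _ _ => ?_
    ring

theorem poleLetter_eq {p q : List R → K} (hq : q [] = 0) (w : List R) :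
    poleLetter ι p q w =
      splL (fun s z c => spl (fun a b => p (a ++ (z + b.sum) :: c) * q b * (ι (z + b.sum))⁻¹) s) w -
      splL (fun a z s => spl (fun b c => p (a ++ (z + b.sum) :: c) * q b * (ι (z + b.sum))⁻¹) s)
        w := by
  have h1 := spl_append_left (fun a f c => p (a ++ f.sum :: c) * q f.dropLast * (ι f.sum)⁻¹)
    (by simp [hq]) w
  have h2 := spl_append_right (fun a f c => p (a ++ f.sum :: c) * q f.tail * (ι f.sum)⁻¹)
    (by simp [hq]) w
  simp only [List.dropLast_concat, List.tail_cons, List.sum_append, List.sum_cons,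
    List.sum_nil, add_zero] at h1 h2
  simp only [add_comm _ (List.sum _)] at h2 ⊢
  rw [h1, h2]
  simp only [poleLetter, mul_sub, spl_sub, mul_right_comm]

/-- `α` is a function on words with values in `K` such that `Δ · α` has values in `R`, given by the
polynomial function `P`, at the words of a set `G`. -/
structure HasPoles (ι : R →+* K) (G : List R → Prop) (α : List R → K) (P : List R → R) :
    Prop where
  nil : α [] = 0
  nil' : P [] = 0
  mul_eq : ∀ w, G w → ι w.prod * ι w.sum * α w = ι (P w)
  sub_mem : ∀ (I : Ideal R) (w w' : List R),
    w.map (Ideal.Quotient.mk I) = w'.map (Ideal.Quotient.mk I) → P w - P w' ∈ I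
  flank : ∀ f, G f → f.sum ∣ P f.dropLast - P f.tail

variable {G : List R → Prop} {α β : List R → K} {P Q : List R → R}

/-- For each contracted factor f the numerator is divisible by Σf, by the field `flank`. -/
theorem poleLetter_mem (hβ : HasPoles ι G β Q) (hsub : ∀ w w', G w → w'.Sublist w → G w')
    (p : List R → R) {w : List R} (hw : G w) :
    poleLetter ι (fun w => ι (p w)) (fun w => ι (Q w)) w ∈ ι.range.toAddSubgroup := by
  refine spl_mem _ fun a t h => spl_mem _ fun f c h' => ?_
  subst h'; subst h
  obtain ⟨k, hk⟩ := hβ.flank f (hsub _ _ hw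
    ((List.sublist_append_left _ _).trans (List.sublist_append_right _ _)))
  -- Since 0⁻¹ = 0, a vanishing sum, as for empty f, contributes zero.
  by_cases h0 : ι f.sum = 0
  · simp [h0]
  · refine ⟨p (a ++ f.sum :: c) * k, ?_⟩
    dsimp only
    rw [← map_sub, hk, map_mul, map_mul]
    field_simp

/-- Modulo Σb both contracted words become ac, so the difference of the values of P is divisible by
Σb. -/
theorem poleFactor_mem (hα : HasPoles ι G α P) (q : List R → R) (w : List R) :
    poleFactor ι (fun w => ι (P w)) (fun w => ι (q w)) w ∈ ι.range.toAddSubgroup := by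
  refine spl_mem _ fun a t _ => spl_mem _ fun b c _ => ?_
  have key : b.sum ∣ (if c = [] then P a else P (a ++ (c.headD 0 + b.sum) :: c.tail)) -
      if a = [] then P c else P (a.dropLast ++ (a.getLastD 0 + b.sum) :: c) := by
    have h0 : Ideal.Quotient.mk (Ideal.span {b.sum}) b.sum = 0 :=
      Ideal.Quotient.eq_zero_iff_mem.2 (Ideal.mem_span_singleton_self _)
    rw [← Ideal.mem_span_singleton]
    rcases List.eq_nil_or_concat a with rfl | ⟨a, z, rfl⟩ <;> rcases c with _ | ⟨y, c⟩
    · simp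
    all_goals
      simp only [if_true, if_false, List.headD_cons, List.tail_cons,
        List.concat_eq_append, List.append_eq_nil_iff, List.cons_ne_nil, and_false,
        List.dropLast_concat, List.getLastD_eq_getLast?, List.getLast?_append,
        List.getLast?_singleton, Option.some_or, Option.getD_some]
      refine hα.sub_mem _ _ _ ?_
      simp [h0]
  obtain ⟨k, hk⟩ := key
  by_cases h0 : ι b.sum = 0
  · simp [h0]
  · refine ⟨q b * k, ?_⟩
    have : ∀ (c : Prop) [Decidable c] (x y : R), (if c then ι x else ι y) = ι (if c then x else y) :=
      fun c _ x y => by split_ifs <;> rfl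
    dsimp only
    rw [this, this, ← map_sub, hk, map_mul, map_mul]
    field_simp

/-- After clearing denominators each term carries z / (Σb (z + Σb)) = 1/Σb − 1/(z + Σb), which
separates the two kinds of poles. -/
theorem mul_aritF (hα : HasPoles ι G α P) (hβ : HasPoles ι G β Q)
    (hsub : ∀ w w', G w → w'.Sublist w → G w') (hperm : ∀ w w', G w → w'.Perm w → G w')
    (hflex : ∀ a b c z, G (a ++ (b ++ z :: c)) → G (a ++ (z + b.sum) :: c))
    (hsum : ∀ w, G w → w ≠ [] → ι w.sum ≠ 0) {w : List R} (hw : G w) :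
    ι w.prod * ι w.sum * aritF β α w =
      splL (fun s z c => spl (fun a b => ι (P (a ++ (z + b.sum) :: c)) * ι (Q b) *
        (ι b.sum)⁻¹) s) w -
      splL (fun a z s => spl (fun b c => ι (P (a ++ (z + b.sum) :: c)) * ι (Q b) *
        (ι b.sum)⁻¹) s) w -
      poleLetter ι (fun w => ι (P w)) (fun w => ι (Q w)) w := by
  have key : ∀ a b c z, G (a ++ (b ++ z :: c)) → w.Perm (a ++ (b ++ z :: c)) →
      ι w.prod * ι w.sum * (α (a ++ (z + b.sum) :: c) * β b) =
      ι (P (a ++ (z + b.sum) :: c)) * ι (Q b) * (ι b.sum)⁻¹ -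
        ι (P (a ++ (z + b.sum) :: c)) * ι (Q b) * (ι (z + b.sum))⁻¹ := by
    intro a b c z hg hp
    rcases eq_or_ne b [] with rfl | hb
    · simp [hβ.nil, hβ.nil']
    have hGb : G b := hsub _ _ hg
      ((List.sublist_append_left _ _).trans (List.sublist_append_right _ _))
    have hGz : G [z + b.sum] := hsub _ _ (hflex _ _ _ _ hg) (by simp)
    have hb0 := hsum b hGb hb
    have hz0 := hsum _ hGz (by simp)
    rw [List.sum_singleton] at hz0
    rw [hp.prod_eq, hp.sum_eq, ← hα.mul_eq _ (hflex _ _ _ _ hg), ← hβ.mul_eq _ hGb]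
    simp only [List.prod_append, List.sum_append, List.prod_cons, List.sum_cons, map_mul,
      map_add] at *
    field_simp
    ring
  rw [poleLetter_eq (by simp [hβ.nil']), aritF, ins, mul_sub]
  simp only [← spl_mul_left, ← splL_mul_left]
  have e1 : splL (fun s z c => spl (fun a b =>
      ι w.prod * ι w.sum * (α (a ++ (z + b.sum) :: c) * β b)) s) w =
      splL (fun s z c => spl (fun a b => ι (P (a ++ (z + b.sum) :: c)) * ι (Q b) *
        (ι b.sum)⁻¹ - ι (P (a ++ (z + b.sum) :: c)) * ι (Q b) * (ι (z + b.sum))⁻¹) s) w := by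
    refine splL_congr fun s z c h1 => spl_congr fun a b h2 => ?_
    have e : w = a ++ (b ++ z :: c) := by rw [h1, h2, List.append_assoc]
    exact key _ _ _ _ (e ▸ hw) (by rw [← e])
  have e2 : splL (fun a z s => spl (fun b c =>
      ι w.prod * ι w.sum * (α (a ++ (z + b.sum) :: c) * β b)) s) w =
      splL (fun a z s => spl (fun b c => ι (P (a ++ (z + b.sum) :: c)) * ι (Q b) *
        (ι b.sum)⁻¹ - ι (P (a ++ (z + b.sum) :: c)) * ι (Q b) * (ι (z + b.sum))⁻¹) s) w := by
    refine splL_congr fun a z s h1 => spl_congr fun b c h2 => ?_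
    have e : (a ++ (b ++ z :: c)).Perm w := by
      rw [h1, h2]
      exact List.perm_middle.append_left a
    exact key _ _ _ _ (hperm _ _ hw e) e.symm
  rw [e1, e2]
  simp only [spl_sub, splL_sub]
  ring

/-- Partial fractions again: (Σa + Σb) / (Σa Σb) = 1/Σa + 1/Σb. -/
theorem mul_muF (hα : HasPoles ι G α P) (hβ : HasPoles ι G β Q)
    (hsub : ∀ w w', G w → w'.Sublist w → G w')
    (hsum : ∀ w, G w → w ≠ [] → ι w.sum ≠ 0) {w : List R} (hw : G w) :
    ι w.prod * ι w.sum * muF α β w =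
      spl (fun a b => ι (P a) * (ι a.sum)⁻¹ * ι (Q b)) w +
        spl (fun a b => ι (Q b) * (ι b.sum)⁻¹ * ι (P a)) w := by
  rw [muF, ← spl_mul_left, ← spl_add]
  refine spl_congr fun a b h => ?_
  subst h
  have ha := hsub _ _ hw (List.sublist_append_left a b)
  have hb := hsub _ _ hw (List.sublist_append_right a b)
  rcases eq_or_ne a [] with rfl | ha'
  · simp [hα.nil, hα.nil']
  rcases eq_or_ne b [] with rfl | hb'
  · simp [hβ.nil, hβ.nil']
  have ha0 := hsum a ha ha'
  have hb0 := hsum b hb hb'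
  rw [← hα.mul_eq _ ha, ← hβ.mul_eq _ hb, List.prod_append, List.sum_append, map_mul, map_add]
  field_simp
  ring

theorem mul_ariF_mem (hα : HasPoles ι G α P) (hβ : HasPoles ι G β Q)
    (hsub : ∀ w w', G w → w'.Sublist w → G w') (hperm : ∀ w w', G w → w'.Perm w → G w')
    (hflex : ∀ a b c z, G (a ++ (b ++ z :: c)) → G (a ++ (z + b.sum) :: c))
    (hsum : ∀ w, G w → w ≠ [] → ι w.sum ≠ 0) {w : List R} (hw : G w) :
    ι w.prod * ι w.sum * ariF α β w ∈ ι.range.toAddSubgroup := by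
  have h : ι w.prod * ι w.sum * ariF α β w =
      (poleFactor ι (fun w => ι (P w)) (fun w => ι (Q w)) w -
        poleLetter ι (fun w => ι (P w)) (fun w => ι (Q w)) w) -
      (poleFactor ι (fun w => ι (Q w)) (fun w => ι (P w)) w -
        poleLetter ι (fun w => ι (Q w)) (fun w => ι (P w)) w) := by
    have h1 := mul_aritF hα hβ hsub hperm hflex hsum hw
    have h2 := mul_aritF hβ hα hsub hperm hflex hsum hw
    have h3 := mul_muF hα hβ hsub hsum hw
    have h4 := mul_muF hβ hα hsub hsum hw
    rw [poleFactor_eq, poleFactor_eq, ariF]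
    linear_combination h1 - h2 + h3 - h4
  rw [h]
  exact sub_mem (sub_mem (poleFactor_mem hα Q w) (poleLetter_mem hβ hsub P hw))
    (sub_mem (poleFactor_mem hβ P w) (poleLetter_mem hα hsub Q hw))

end Poles

end WordSum

/-! ### Moulds with poles bounded by Δ -/

namespace Mould

open WordSum

section Polynomial

variable {S T : Type*} [CommRing S] [Algebra ℚ S] [CommRing T] [Algebra ℚ T]

/-- The value of a family of polynomials, one for each number of variables, at a word. -/
noncomputable def polyWord (P : (n : ℕ) → MvPolynomial (Fin n) ℚ) (w : List S) : S :=
  MvPolynomial.aeval w.get (P w.length)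

theorem map_polyWord (φ : S →ₐ[ℚ] T) (P : (n : ℕ) → MvPolynomial (Fin n) ℚ) (w : List S) :
    φ (polyWord P w) = polyWord P (w.map φ) := by
  have h : ∀ (n : ℕ) (v : List T) (h : v.length = n),
      MvPolynomial.aeval (fun i => v.get (i.cast h.symm)) (P n) = polyWord P v := by
    rintro n v rfl; rfl
  rw [← h w.length (w.map φ) (List.length_map φ), polyWord, MvPolynomial.comp_aeval_apply]
  simp

theorem polyWord_sub_mem (P : (n : ℕ) → MvPolynomial (Fin n) ℚ) (I : Ideal S) (w w' : List S)
    (h : w.map (Ideal.Quotient.mk I) = w'.map (Ideal.Quotient.mk I)) :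
    polyWord P w - polyWord P w' ∈ I := by
  rw [← Ideal.Quotient.mk_eq_mk_iff_sub_mem, ← Ideal.Quotient.mkₐ_eq_mk ℚ, map_polyWord,
    map_polyWord]
  rw [← Ideal.Quotient.mkₐ_eq_mk ℚ] at h
  rw [h]

end Polynomial

section Sing

variable {r : ℕ}

/-- The embedding of polynomials into rational functions. -/
noncomputable abbrev polyHom (r : ℕ) : MvPolynomial (Fin r) ℚ →ₐ[ℚ] RatFun r :=
  Algebra.algHom ℚ (MvPolynomial (Fin r) ℚ) (RatFun r)

theorem polyHom_injective : Function.Injective (polyHom r) :=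
  IsFractionRing.injective (MvPolynomial (Fin r) ℚ) (RatFun r)

theorem mul_evalWord {K : Type*} [Field K] [Algebra ℚ K] {e : Fin r → K}
    (he : AlgebraicIndependent ℚ e) {A : Mould} {P : (n : ℕ) → MvPolynomial (Fin n) ℚ}
    (hP : ∀ n, Δ n * A n = algebraMap _ (RatFun n) (P n)) {w : List K} (hw : Gen e w) :
    w.prod * w.sum * A.evalWord w = polyWord P w := by
  have h := congrArg (RatFun.evalHom (hw.algebraicIndependent he)) (hP w.length)
  rw [RatFun.evalHom_algebraMap, map_mul, ← evalWord_eq_evalHom he hw A] at h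
  have h1 : Δ w.length = (vars w.length).prod * (vars w.length).sum := by
    rw [Δ, vars, List.prod_ofFn, List.sum_ofFn]
  rw [h1, map_mul, map_list_prod, map_list_sum, map_vars_evalHom he hw] at h
  exact h

theorem Gen.sum_ne_zero {K : Type*} [Field K] [Algebra ℚ K] {e : Fin r → K} {w : List K}
    (hw : Gen e w) (h : w ≠ []) : w.sum ≠ 0 := by
  intro h0
  have hs : ∑ i : Fin w.length, (1 : ℚ) • w.get i = 0 := by
    rw [← h0]
    conv_rhs => rw [← List.ofFn_get w, List.sum_ofFn]
    simp
  exact one_ne_zero (Fintype.linearIndependent_iff.1 hw.2 (fun _ => 1) hs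
    ⟨0, List.length_pos_of_ne_nil h⟩)

theorem Gen.push {K : Type*} [Field K] [Algebra ℚ K] {e : Fin r → K} {m : List K} {y : K}
    (h : Gen e (m ++ [y])) : Gen e (-(m.sum + y) :: m) := by
  have hm : ∀ S : Submodule ℚ K, (∀ x ∈ m, x ∈ S) → m.sum ∈ S := fun S hS => list_sum_mem hS
  refine h.of_span (by simp) ?_ ?_
  · rw [List.forall_mem_cons]
    have hm' : ∀ x ∈ m, x ∈ Submodule.span ℚ {x | x ∈ m ++ [y]} :=
      fun x hx => Submodule.subset_span (List.mem_append_left _ hx)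
    exact ⟨neg_mem (add_mem (hm _ hm') (Submodule.subset_span (by simp))), hm'⟩
  · rw [List.forall_mem_append]
    have hm' : ∀ x ∈ m, x ∈ Submodule.span ℚ {x | x ∈ -(m.sum + y) :: m} :=
      fun x hx => Submodule.subset_span (List.mem_cons_of_mem _ hx)
    refine ⟨hm', ?_⟩
    simp only [List.mem_singleton, forall_eq]
    have hy : y = -(-(m.sum + y)) - m.sum := by ring
    have h1 : -(m.sum + y) ∈ Submodule.span ℚ {x | x ∈ -(m.sum + y) :: m} :=
      Submodule.subset_span (by simp)
    have h2 := sub_mem (neg_mem h1) (hm _ hm')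
    rwa [← hy] at h2

/-- The point is the field `flank`. For f = z m y, push-invariance replaces the word my by −(Σm + y)
followed by m, and modulo Σf this first letter is z. -/
theorem hasPoles {A : Mould} (hA : A ∈ ARIalal) {P : (n : ℕ) → MvPolynomial (Fin n) ℚ}
    (hP0 : P 0 = 0) (hP : ∀ n, Δ n * A n = algebraMap _ (RatFun n) (P n)) :
    HasPoles (polyHom r).toRingHom (fun w => Gen var (w.map (polyHom r)))
      (fun w => fn var A (w.map (polyHom r))) (polyWord P) := by
  have hu := algebraicIndependent_var (r := r)
  have hmul : ∀ w : List (MvPolynomial (Fin r) ℚ), Gen var (w.map (polyHom r)) →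
      polyHom r w.prod * polyHom r w.sum * fn var A (w.map (polyHom r)) =
        polyHom r (polyWord P w) := by
    intro w hw
    rw [fn_of_gen hw, map_list_prod, map_list_sum, mul_evalWord hu hP hw, map_polyWord]
  have hnil : polyWord P ([] : List (MvPolynomial (Fin r) ℚ)) = 0 := by
    change MvPolynomial.aeval _ (P 0) = 0
    rw [hP0, map_zero]
  refine ⟨fn_nil hA.1, hnil, hmul, fun I w w' h => polyWord_sub_mem P I w w' h, fun f hf => ?_⟩
  rcases f with _ | ⟨z, f⟩
  · simp
  rcases List.eq_nil_or_concat f with rfl | ⟨m, y, rfl⟩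
  · simp [hnil]
  rw [List.concat_eq_append] at *
  have hg : Gen var ((m ++ [y]).map (polyHom r)) := hf.sublist (by simp)
  have e1 : (-(m.sum + y) :: m).map (polyHom r) =
      -((m.map (polyHom r)).sum + polyHom r y) :: m.map (polyHom r) := by
    rw [List.map_cons, map_neg, map_add, map_list_sum]
  have hg' : Gen var ((-(m.sum + y) :: m).map (polyHom r)) := by
    rw [e1]
    exact Gen.push (by simpa using hg)
  have hpush := (isPushInv_fn hu hA).apply_append_singleton (m.map (polyHom r)) (polyHom r y)
  -- Δ is itself invariant under the push, so the invariance passes from A to its numerator.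
  have e : polyWord P (m ++ [y]) = polyWord P (-(m.sum + y) :: m) := by
    apply polyHom_injective
    rw [← hmul _ hg, ← hmul _ hg']
    rw [e1, ← hpush, List.map_append, List.map_singleton, ← map_mul, ← map_mul]
    congr 2
    simp only [List.prod_append, List.sum_append, List.prod_cons, List.sum_cons, List.prod_nil,
      List.sum_nil]
    ring
  rw [List.tail_cons, e, ← List.cons_append, List.dropLast_concat, ← Ideal.mem_span_singleton]
  refine polyWord_sub_mem P _ _ _ ?_
  rw [List.map_cons, List.map_cons]
  congr 1
  rw [Ideal.Quotient.mk_eq_mk_iff_sub_mem, Ideal.mem_span_singleton]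
  refine dvd_of_eq ?_
  simp
  ring

theorem exists_poly_of_mem_ARIsing {A : Mould} (hA : A ∈ ARIsing) :
    ∃ P : (n : ℕ) → MvPolynomial (Fin n) ℚ, P 0 = 0 ∧
      ∀ n, Δ n * A n = algebraMap _ (RatFun n) (P n) := by
  choose! P hP using hA.2
  refine ⟨fun n => if n = 0 then 0 else P n, if_pos rfl, fun n => ?_⟩
  rcases Nat.eq_zero_or_pos n with rfl | hn
  · have : A 0 = 0 := hA.1
    simp [this]
  · change _ = algebraMap _ _ (if n = 0 then 0 else P n)
    rw [if_neg hn.ne', hP n hn]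

theorem ari_mem_ARIsing {A B : Mould} (hA : A ∈ ARIalal) (hB : B ∈ ARIalal)
    (hA' : A ∈ ARIsing) (hB' : B ∈ ARIsing) : ari A B ∈ ARIsing := by
  refine ⟨ari_mem_ARI hA.1 hB.1, fun r _ => ?_⟩
  obtain ⟨P, hP0, hP⟩ := exists_poly_of_mem_ARIsing hA'
  obtain ⟨Q, hQ0, hQ⟩ := exists_poly_of_mem_ARIsing hB'
  set W : List (MvPolynomial (Fin r) ℚ) := List.ofFn MvPolynomial.X with hW
  have hWv : W.map (polyHom r) = vars r := by
    rw [hW, List.map_ofFn]; rfl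
  obtain ⟨q, hq⟩ := mul_ariF_mem (hasPoles (r := r) hA hP0 hP) (hasPoles (r := r) hB hQ0 hQ)
    (fun w w' h hs => h.sublist (hs.map _)) (fun w w' h hs => h.perm (hs.map _))
    (fun a b c z h => by
      have := Gen.flex (e := var) (a := a.map (polyHom r)) (b := b.map (polyHom r))
        (c := c.map (polyHom r)) (z := polyHom r z) (by simpa using h)
      simpa [map_list_sum] using this)
    (fun w h hw => by
      have := h.sum_ne_zero (by simpa using hw)
      rwa [← map_list_sum] at this)
    (w := W) (by rw [hWv]; exact gen_vars)
  refine ⟨q, ?_⟩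
  have h1 := ariF_map (polyHom r).toRingHom.toAddMonoidHom (fn var A) (fn var B) W
  change ariF _ _ (W.map (polyHom r)) = ariF (fun w => fn var A (w.map (polyHom r)))
    (fun w => fn var B (w.map (polyHom r))) W at h1
  rw [← h1, hWv, ← ari_apply hA.1 hB.1] at hq
  change polyHom r q = polyHom r W.prod * polyHom r W.sum * _ at hq
  rw [map_list_prod, map_list_sum, hWv] at hq
  rw [Δ]
  rw [vars, List.prod_ofFn, List.sum_ofFn] at hq
  exact hq.symm

end Sing

/-! ### The Lie algebra structure -/

section Lie

/-- `RatFun.eval` uses reduced fractions and is not visibly additive, whereas `fn` is linear in the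
mould; in this form the conditions are visibly linear. -/
theorem mem_ARIalal_iff {A : Mould} : A ∈ ARIalal ↔ A ∈ ARI ∧
    (∀ r s : ℕ, 1 ≤ s → s < r → sh (fn var A) ((vars r).take s) ((vars r).drop s) = 0) ∧
    (∀ r s : ℕ, 1 ≤ s → s < r →
      sh (fun w => fn var A (dif 0 w.reverse)) ((vars r).take s) ((vars r).drop s) = 0) ∧
    fn (var (r := 1)) A [-var 0] = fn var A [var 0] := by
  have hg : ∀ (r s : ℕ) (w : List (RatFun r)),
      w.Perm ((vars r).take s ++ (vars r).drop s) → Gen var w := by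
    intro r s w hw
    rw [List.take_append_drop] at hw
    exact gen_vars.perm hw
  have h1 : Gen (var (r := 1)) [var 0] := gen_vars
  refine and_congr_right fun _ => and_congr ?_ (and_congr ?_ ?_)
  · rw [isAlternal_iff]
    refine forall_congr' fun r => forall_congr' fun s => imp_congr_right fun _ =>
      imp_congr_right fun _ => ?_
    rw [sh_congr fun w hw => fn_of_gen (hg r s w hw) A]
  · rw [isAlternal_iff]
    refine forall_congr' fun r => forall_congr' fun s => imp_congr_right fun _ =>
      imp_congr_right fun _ => ?_
    rw [sh_congr fun w hw => (evalWord_swap algebraicIndependent_var (hg r s w hw) A).trans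
      (fn_of_gen (gen_dif_iff.2 ((hg r s w hw).perm w.reverse_perm)) A).symm]
  · rw [fn_of_gen h1, fn_of_gen h1.neg_singleton]
    have e1 : A.evalWord [-var (r := 1) 0] = RatFun.eval (A 1) (fun i => -var i) :=
      (evalWord_ofFn A fun i => -var (r := 1) i)
    have e2 : A.evalWord [var (r := 1) 0] = A 1 := evalWord_vars A 1
    rw [e1, e2]

/-- The space of bialternal moulds with even depth one part and with poles bounded by `Δ`. -/
noncomputable def singSubmodule : Submodule ℚ Mould where
  carrier := ARIalal ∩ ARIsing
  add_mem' := by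
    rintro A B ⟨hA, hA'⟩ ⟨hB, hB'⟩
    have h0 : A + B ∈ ARI := by
      change A 0 + B 0 = 0
      rw [show A 0 = 0 from hA.1, show B 0 = 0 from hB.1, add_zero]
    refine ⟨?_, h0, fun r hr => ?_⟩
    · rw [mem_ARIalal_iff] at *
      have hf := fun r => fn_add (algebraicIndependent_var (r := r)) A B
      refine ⟨h0, fun r s h1 h2 => ?_, fun r s h1 h2 => ?_, ?_⟩
      · rw [hf]
        exact (sh_add _ _ _ _).trans (by rw [hA.2.1 r s h1 h2, hB.2.1 r s h1 h2, add_zero])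
      · rw [hf]
        exact (sh_add _ _ _ _).trans (by rw [hA.2.2.1 r s h1 h2, hB.2.2.1 r s h1 h2, add_zero])
      · rw [hf, Pi.add_apply, Pi.add_apply, hA.2.2.2, hB.2.2.2]
    · obtain ⟨p, hp⟩ := hA'.2 r hr
      obtain ⟨q, hq⟩ := hB'.2 r hr
      exact ⟨p + q, by rw [Pi.add_apply, mul_add, hp, hq, map_add]⟩
  zero_mem' := by
    have h0 : (0 : Mould) ∈ ARI := rfl
    refine ⟨?_, h0, fun r _ => ⟨0, by simp⟩⟩
    rw [mem_ARIalal_iff]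
    have hf : ∀ r, fn (var (r := r)) 0 = 0 := fun r => by
      simpa using fn_add (algebraicIndependent_var (r := r)) 0 0
    refine ⟨h0, fun r s _ _ => ?_, fun r s _ _ => ?_, ?_⟩
    · rw [hf]; exact sh_zero _ _
    · rw [hf]; exact sh_zero _ _
    · rw [hf]; rfl
  smul_mem' := by
    rintro k A ⟨hA, hA'⟩
    have h0 : k • A ∈ ARI := by
      change k • A 0 = 0
      rw [show A 0 = 0 from hA.1, RatFun.smul_eq, mul_zero]
    refine ⟨?_, h0, fun r hr => ?_⟩
    · rw [mem_ARIalal_iff] at *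
      have hf := fun r => fn_smul (algebraicIndependent_var (r := r)) k A
      refine ⟨h0, fun r s h1 h2 => ?_, fun r s h1 h2 => ?_, ?_⟩
      · rw [hf]
        exact (sh_mul_left _ _ _ _).trans (by rw [hA.2.1 r s h1 h2, mul_zero])
      · rw [hf]
        exact (sh_mul_left _ _ _ _).trans (by rw [hA.2.2.1 r s h1 h2, mul_zero])
      · rw [hf, Pi.smul_apply, Pi.smul_apply, hA.2.2.2]
    · obtain ⟨p, hp⟩ := hA'.2 r hr
      refine ⟨MvPolynomial.C k * p, ?_⟩
      rw [Pi.smul_apply, RatFun.smul_eq, mul_left_comm, hp, map_mul]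
      congr 1
      exact (eq_ratCast ((algebraMap (MvPolynomial (Fin r) ℚ) (RatFun r)).comp MvPolynomial.C)
        k).symm

theorem ari_mem {A B : Mould} (hA : A ∈ ARIalal ∩ ARIsing) (hB : B ∈ ARIalal ∩ ARIsing) :
    ari A B ∈ ARIalal ∩ ARIsing :=
  ⟨ari_mem_ARIalal hA.1 hB.1, ari_mem_ARIsing hA.1 hB.1 hA.2 hB.2⟩

variable {A B C : Mould}

theorem ari_add_left (hA : A ∈ ARI) (hB : B ∈ ARI) (hAB : A + B ∈ ARI) (hC : C ∈ ARI) :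
    ari (A + B) C = ari A C + ari B C := by
  funext r
  rw [Pi.add_apply, ari_apply hAB hC, ari_apply hA hC, ari_apply hB hC,
    fn_add algebraicIndependent_var, ariF_add_left, Pi.add_apply]

theorem ari_add_right (hA : A ∈ ARI) (hB : B ∈ ARI) (hAB : A + B ∈ ARI) (hC : C ∈ ARI) :
    ari C (A + B) = ari C A + ari C B := by
  funext r
  rw [Pi.add_apply, ari_apply hC hAB, ari_apply hC hA, ari_apply hC hB,
    fn_add algebraicIndependent_var, ariF_add_right, Pi.add_apply]

theorem ari_smul_right (k : ℚ) (hA : A ∈ ARI) (hkA : k • A ∈ ARI) (hC : C ∈ ARI) :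
    ari C (k • A) = k • ari C A := by
  funext r
  rw [Pi.smul_apply, ari_apply hC hkA, ari_apply hC hA, fn_smul algebraicIndependent_var,
    ariF_smul_right, Pi.smul_apply, RatFun.smul_eq, smul_eq_mul, eq_ratCast]

theorem ari_self (hA : A ∈ ARI) : ari A A = 0 := by
  funext r
  rw [ari_apply hA hA, ariF_self]
  rfl

theorem ari_jacobi (hA : A ∈ ARI) (hB : B ∈ ARI) (hC : C ∈ ARI) :
    ari A (ari B C) = ari (ari A B) C + ari B (ari A C) := by
  funext r
  have hf : ∀ {A B : Mould}, A ∈ ARI → B ∈ ARI → ∀ w : List (RatFun r), Gen var w →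
      fn var (ari A B) w = ariF (fn var A) (fn var B) w :=
    fun hA hB w hw => fn_ari algebraicIndependent_var hA hB hw
  -- `fn` of an inner bracket agrees with `ariF` at generic words only, so the replacement goes
  -- through `ariF_congr`; this trivial equality serves the unchanged argument.
  have hs : ∀ A : Mould, ∀ w : List (RatFun r), Gen var w → fn var A w = fn var A w :=
    fun _ _ _ => rfl
  rw [Pi.add_apply, ari_apply hA (ari_mem_ARI hB hC), ari_apply (ari_mem_ARI hA hB) hC,
    ari_apply hB (ari_mem_ARI hA hC), ariF_congr gen_vars (hs A) (hf hB hC),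
    ariF_congr gen_vars (hf hA hB) (hs C), ariF_congr gen_vars (hs B) (hf hA hC),
    ariF_jacobi (fn_nil hA) (fn_nil hB) (fn_nil hC), Pi.add_apply]

noncomputable instance : LieRing singSubmodule where
  bracket A B := ⟨ari A B, ari_mem A.2 B.2⟩
  add_lie A B C := Subtype.ext (ari_add_left A.2.1.1 B.2.1.1 (A + B).2.1.1 C.2.1.1)
  lie_add A B C := Subtype.ext (ari_add_right B.2.1.1 C.2.1.1 (B + C).2.1.1 A.2.1.1)
  lie_self A := Subtype.ext (ari_self A.2.1.1)
  leibniz_lie A B C := Subtype.ext (ari_jacobi A.2.1.1 B.2.1.1 C.2.1.1)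

noncomputable instance : LieAlgebra ℚ singSubmodule where
  lie_smul k A B := Subtype.ext (ari_smul_right k B.2.1.1 (k • B).2.1.1 A.2.1.1)

end Lie

end Mould

theorem mainTheorem2 :
    (∀ A B : Mould, A ∈ Mould.ARIalal ∩ Mould.ARIsing → B ∈ Mould.ARIalal ∩ Mould.ARIsing →
      Mould.ari A B ∈ Mould.ARIalal ∩ Mould.ARIsing) ∧
    ∃ (L : Type) (_ : LieRing L) (_ : LieAlgebra ℚ L) (ι : L →ₗ[ℚ] Mould),
      Function.Injective ι ∧ Set.range ι = Mould.ARIalal ∩ Mould.ARIsing ∧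
      ∀ x y : L, ι ⁅x, y⁆ = Mould.ari (ι x) (ι y) :=
  ⟨fun _ _ hA hB => Mould.ari_mem hA hB, Mould.singSubmodule, inferInstance, inferInstance,
    Mould.singSubmodule.subtype, Subtype.val_injective, Subtype.range_val, fun _ _ => rfl⟩
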